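/- **System.** Fix a horizon $T$ and finite mode sets $\mathcal M^n=\{1,\dots,\kappa^n\}$, $n=0,1$. For $t=0,\dots,T$, $$X^0_{t+1}=A^{00}(M^0_t)X^0_t+B^{00}(M^0_t)U^0_t+W^0_t,$$ $$X^1_{t+1}=A^{10}(M^{0:1}_t)X^0_t+A^{11}(M^{0:1}_t)X^1_t+B^{10}(M^{0:1}_t)U^0_t+B^{11}(M^{0:1}_t)U^1_t+W^1_t,$$ with $X^n_t\in\mathbb R^{d_X^n}$, $U^n_t\in\mathbb R^{d_U^n}$, $M_t^n\in\mathcal M^n$. The random variables $X^n_0, W^n_t, M^n_t,\Gamma_t$ ($n=0,1$, $0\le t\le T$) are mutually independent; $X^n_0\sim\pi_{X^n_0}$ and $W^n_t\sim\pi_{W^n_t}$ have finite second moments, $W^n_t$ has zero mean, $M^n_t\sim\pi_{M^n}$, and $\Gamma_t\in\{0,1\}$ has a law $p$ that does not depend on $t$. The channel output is $(Z_t,\tilde Z_t)=(X^1_t,M^1_t)$ if $\Gamma_t=1$ and $(\emptyset,\emptyset)$ if $\Gamma_t=0$. The common information is $H^0_t=(X^0_{0:t},M^0_{0:t},Z_{0:t},\tilde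 Z_{0:t},U^0_{0:t-1})$, with set of realizations $\mathcal H^0_t$. The instantaneous cost is $c_t(x^{0:1},m^{0:1},u^{0:1})=x^\top Q_t(m^{0:1})x+u^\top R_t(m^{0:1})u$, where $x=(x^0,x^1)$, $u=(u^0,u^1)$, $Q_t(m^{0:1})$ is symmetric positive semidefinite and $R_t(m^{0:1})$ is symmetric positive definite. **Problem 2.** Let $\mathcal P$ be the set of measurable maps $\rho:\mathbb R^{d_X^1}\times\mathcal M^1\to\mathbb R^{d_U^1}$. A prescription strategy $\phi=(\phi_t)_{0\le t\le T}$ maps $h^0_t\in\mathcal H^0_t$ to a prescription $(u^0_t,\rho_t)\in\mathbb R^{d_U^0}\times\mathcal P$; the applied controls are $U^0_t=u^0_t$ and $U^1_t=\rho_t(X^1_t,M^1_t)$. It is feasible ($\phi\in\Phi^{prs}$) if $h^0_t\mapsto u^0_t$ and $(h^0_t,x^1,m^1)\mapsto\rho_t(x^1,m^1)$ are Borel measurable and all states and controls have finite second moments. Problem 2 is to minimize $\mathbb E^{\phi}\big[\sum_{t=0}^T c_t(X^{0:1}_t,M^{0:1}_t,U^{0:1}_t)\big]$ over $\phi\in\Phi^{prs}$.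 **Belief.** For $\tilde z\in\tilde{\mathcal M}^1=\mathcal M^1\cup\{\emptyset\}$ let $\omega^{\emptyset}=\pi_{M^1}$ and $\omega^{l}=\delta_l$ for $l\in\mathcal M^1$. Define $\psi_t(\theta,(u^0,\rho),x^0,m^0,\tilde z,z')$ to be $\delta_{x'}$ if $z'=x'\in\mathbb R^{d_X^1}$. If $z'=\emptyset$, it is the law of $$A^{10}(m^0,M)x^0+A^{11}(m^0,M)X+B^{10}(m^0,M)u^0+B^{11}(m^0,M)\rho(X,M)+W,$$ where $X\sim\theta$, $M\sim\omega^{\tilde z}$, $W\sim\pi_{W^1_t}$ are independent. Under $\phi$, the belief $\theta_t=\theta_t(h^0_t)$ is given by $\theta_0=\pi_{X_0^1}$ if $z_0=\emptyset$, $\theta_0=\delta_{x_0^1}$ if $z_0=x^1_0$, and $\theta_{t+1}=\psi_t(\theta_t,\phi_t(h^0_t),x^0_t,m^0_t,\tilde z_t,z_{t+1})$. **Theorem.** Let $\Delta(\mathbb R^{d_X^1})$ be the set of probability measures on $\mathbb R^{d_X^1}$ with finite second moment. Suppose there are functions $V_t:\mathbb R^{d_X^0}\times\mathcal M^0\times\Delta(\mathbb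 R^{d_X^1})\times\tilde{\mathcal M}^1\to\mathbb R$, $t=0,\dots,T+1$, with $V_{T+1}=0$ such that for all $t=0,\dots,T$ and all $(x^0,m^0,\theta,\tilde z)$ $$V_t(x^0,m^0,\theta,\tilde z)=\min_{u^0\in\mathbb R^{d_U^0},\ \rho\in\mathcal P}\mathbb E\Big[c_t\big(x^0,X,m^0,M,u^0,\rho(X,M)\big)+V_{t+1}\big(X^{0\prime},M^{0\prime},\psi_t(\theta,(u^0,\rho),x^0,m^0,\tilde z,Z'),\tilde Z'\big)\Big].$$ Here $X\sim\theta$, $M\sim\omega^{\tilde z}$, $W^n\sim\pi_{W_t^n}$, $M^{n\prime}\sim\pi_{M^n}$, $\Gamma'\sim p$ are independent, $X^{0\prime},X^{1\prime}$ are the next states from $(x^0,X)$ with modes $(m^0,M)$, controls $(u^0,\rho(X,M))$ and noises $W^0,W^1$, and $(Z',\tilde Z')=(X^{1\prime},M^{1\prime})$ if $\Gamma'=1$ and $(\emptyset,\emptyset)$ if $\Gamma'=0$. The expectation takes values in $[-\infty,+\infty]$, and $V_{t+1}$ is read as $+\infty$ at a measure outside $\Delta(\mathbb R^{d_X^1})$.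 Suppose further that some $\phi^*\in\Phi^{prs}$ is such that, for all $t\le T$ and all $h^0_t\in\mathcal H^0_t$ with belief $\theta_t$ under $\phi^*$, the prescription $\phi^*_t(h^0_t)$ attains the minimum defining $V_t(x^0_t,m^0_t,\theta_t,\tilde z_t)$. Then $\phi^*$ is optimal for Problem 2. Moreover, for every $\phi\in\Phi^{prs}$, every $t\le T$ and every Borel set $E\subseteq\mathbb R^{d_X^1}$, $\theta_t(H^0_t)(E)=\mathbb P^{\phi}(X^1_t\in E\mid H^0_t)$ almost surely, so that this conditional law evolves by the update $\psi_t$, which does not depend on the strategy. -/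

import Mathlib

open MeasureTheory ProbabilityTheory
open scoped Matrix ENNReal

namespace NCS

noncomputable section

/-- The disjoint-union σ-algebra on `Option α`: a set is measurable iff its trace on `α` is. -/
instance instMeasurableSpaceOption {α : Type*} [m : MeasurableSpace α] :
    MeasurableSpace (Option α) :=
  MeasurableSpace.map some m

/-- The data of the two-plant switched linear system: horizon, dimensions, numbers of modes, system
matrices, cost matrices and the laws of the primitive random variables. Sequences are indexed by
`ℕ`; only the times `0, …, T` matter. A vector of `ℝ^d` is a function `Fin d → ℝ`. -/
structure SwitchedSystem where
  T : ℕ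
  dX0 : ℕ
  dX1 : ℕ
  dU0 : ℕ
  dU1 : ℕ
  κ0 : ℕ
  κ1 : ℕ
  A00 : Fin κ0 → Matrix (Fin dX0) (Fin dX0) ℝ
  A10 : Fin κ0 → Fin κ1 → Matrix (Fin dX1) (Fin dX0) ℝ
  A11 : Fin κ0 → Fin κ1 → Matrix (Fin dX1) (Fin dX1) ℝ
  B00 : Fin κ0 → Matrix (Fin dX0) (Fin dU0) ℝ
  B10 : Fin κ0 → Fin κ1 → Matrix (Fin dX1) (Fin dU0) ℝ
  B11 : Fin κ0 → Fin κ1 → Matrix (Fin dX1) (Fin dU1) ℝ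
  Q : ℕ → Fin κ0 → Fin κ1 → Matrix (Fin dX0 ⊕ Fin dX1) (Fin dX0 ⊕ Fin dX1) ℝ
  R : ℕ → Fin κ0 → Fin κ1 → Matrix (Fin dU0 ⊕ Fin dU1) (Fin dU0 ⊕ Fin dU1) ℝ
  Q_posSemidef : ∀ t ≤ T, ∀ m0 m1, (Q t m0 m1).PosSemidef
  R_posDef : ∀ t ≤ T, ∀ m0 m1, (R t m0 m1).PosDef
  /-- laws of the initial states -/
  lawX0 : ProbabilityMeasure (Fin dX0 → ℝ)
  lawX1 : ProbabilityMeasure (Fin dX1 → ℝ)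
  /-- laws of the noises at each time -/
  lawW0 : ℕ → ProbabilityMeasure (Fin dX0 → ℝ)
  lawW1 : ℕ → ProbabilityMeasure (Fin dX1 → ℝ)
  /-- laws of the modes, the same at all times -/
  lawM0 : ProbabilityMeasure (Fin κ0)
  lawM1 : ProbabilityMeasure (Fin κ1)
  /-- law of the link state, the same at all times; `true` is a successful transmission -/
  lawΓ : ProbabilityMeasure Bool
  lawX0_memLp : MemLp id 2 (lawX0 : Measure (Fin dX0 → ℝ))
  lawX1_memLp : MemLp id 2 (lawX1 : Measure (Fin dX1 → ℝ))
  lawW0_memLp : ∀ t ≤ T, MemLp id 2 (lawW0 t : Measure (Fin dX0 → ℝ))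
  lawW1_memLp : ∀ t ≤ T, MemLp id 2 (lawW1 t : Measure (Fin dX1 → ℝ))
  lawW0_mean : ∀ t ≤ T, ∫ w, w ∂(lawW0 t : Measure (Fin dX0 → ℝ)) = 0
  lawW1_mean : ∀ t ≤ T, ∫ w, w ∂(lawW1 t : Measure (Fin dX1 → ℝ)) = 0

namespace SwitchedSystem

/-- Global states. -/
abbrev X0 (S : SwitchedSystem) : Type := Fin S.dX0 → ℝ
/-- Local states. -/
abbrev X1 (S : SwitchedSystem) : Type := Fin S.dX1 → ℝ
/-- Actions of the global controller. -/
abbrev U0 (S : SwitchedSystem) : Type := Fin S.dU0 → ℝ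
/-- Actions of the local controller. -/
abbrev U1 (S : SwitchedSystem) : Type := Fin S.dU1 → ℝ
/-- Global modes. -/
abbrev M0 (S : SwitchedSystem) : Type := Fin S.κ0
/-- Local modes. -/
abbrev M1 (S : SwitchedSystem) : Type := Fin S.κ1

variable (S : SwitchedSystem)

/-- Next global state. -/
def next0 (m0 : S.M0) (x0 : S.X0) (u0 : S.U0) (w0 : S.X0) : S.X0 :=
  S.A00 m0 *ᵥ x0 + S.B00 m0 *ᵥ u0 + w0

/-- Next local state. -/
def next1 (m0 : S.M0) (m1 : S.M1) (x0 : S.X0) (x1 : S.X1) (u0 : S.U0) (u1 : S.U1) (w1 : S.X1) :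
    S.X1 :=
  S.A10 m0 m1 *ᵥ x0 + S.A11 m0 m1 *ᵥ x1 + S.B10 m0 m1 *ᵥ u0 + S.B11 m0 m1 *ᵥ u1 + w1

/-- Instantaneous quadratic cost. -/
def cost (t : ℕ) (x0 : S.X0) (x1 : S.X1) (m0 : S.M0) (m1 : S.M1) (u0 : S.U0) (u1 : S.U1) : ℝ :=
  Sum.elim x0 x1 ⬝ᵥ (S.Q t m0 m1 *ᵥ Sum.elim x0 x1) +
    Sum.elim u0 u1 ⬝ᵥ (S.R t m0 m1 *ᵥ Sum.elim u0 u1)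

/-- Channel output: the pair `(Z, Z̃)` is `some (x1, m1)` on success and `none`, standing for
`(∅, ∅)`, on failure. -/
def channel (γ : Bool) (x1 : S.X1) (m1 : S.M1) : Option (S.X1 × S.M1) :=
  if γ then some (x1, m1) else none

/-- What becomes commonly known at one time: global state, global mode, channel output. -/
abbrev Obs : Type := S.X0 × S.M0 × Option (S.X1 × S.M1)

/-- Realizations of the common information at time `t`: the observations at times `0, …, t` and
the actions of the global controller at times `0, …, t - 1`. -/
abbrev Hist (t : ℕ) : Type := (Fin (t + 1) → S.Obs) × (Fin t → S.U0)

variable {S}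

namespace Hist

/-- Current global state. -/
def x0 {t : ℕ} (h : S.Hist t) : S.X0 := (h.1 (Fin.last t)).1
/-- Current global mode. -/
def m0 {t : ℕ} (h : S.Hist t) : S.M0 := (h.1 (Fin.last t)).2.1
/-- Current channel output for the local state. -/
def z {t : ℕ} (h : S.Hist t) : Option S.X1 := (h.1 (Fin.last t)).2.2.map Prod.fst
/-- Current channel output for the local mode. -/
def zt {t : ℕ} (h : S.Hist t) : Option S.M1 := (h.1 (Fin.last t)).2.2.map Prod.snd
/-- The common information one step earlier. -/
def past {t : ℕ} (h : S.Hist (t + 1)) : S.Hist t := (Fin.init h.1, Fin.init h.2)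
/-- The initial common information. -/
def start (o : S.Obs) : S.Hist 0 := (fun _ => o, Fin.elim0)
/-- Common information extended by the last global action and a new observation. -/
def extend {t : ℕ} (h : S.Hist t) (u0 : S.U0) (o : S.Obs) : S.Hist (t + 1) :=
  (Fin.snoc (α := fun _ => S.Obs) h.1 o, Fin.snoc (α := fun _ => S.U0) h.2 u0)

end Hist

variable (S)

/-- A prescription strategy: at each time the common information is mapped to an action of the
global controller and a prescription for the local controller. -/
structure Strategy where
  act : (t : ℕ) → S.Hist t → S.U0
  prs : (t : ℕ) → S.Hist t → S.X1 × S.M1 → S.U1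

/-- Index set of the primitive random variables. -/
inductive PrimIdx (T : ℕ) : Type
  | x0 : PrimIdx T
  | x1 : PrimIdx T
  | w0 (t : Fin (T + 1)) : PrimIdx T
  | w1 (t : Fin (T + 1)) : PrimIdx T
  | m0 (t : Fin (T + 1)) : PrimIdx T
  | m1 (t : Fin (T + 1)) : PrimIdx T
  | γ (t : Fin (T + 1)) : PrimIdx T

/-- The primitive random variables of the system on a probability space, with the prescribed laws
and mutually independent. -/
structure Noise {Ω : Type*} [MeasurableSpace Ω] (P : Measure Ω) where
  X0 : Ω → S.X0
  X1 : Ω → S.X1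
  W0 : ℕ → Ω → S.X0
  W1 : ℕ → Ω → S.X1
  M0 : ℕ → Ω → S.M0
  M1 : ℕ → Ω → S.M1
  Γ : ℕ → Ω → Bool
  hasLaw_X0 : HasLaw X0 S.lawX0 P
  hasLaw_X1 : HasLaw X1 S.lawX1 P
  hasLaw_W0 : ∀ t ≤ S.T, HasLaw (W0 t) (S.lawW0 t) P
  hasLaw_W1 : ∀ t ≤ S.T, HasLaw (W1 t) (S.lawW1 t) P
  hasLaw_M0 : ∀ t ≤ S.T, HasLaw (M0 t) S.lawM0 P
  hasLaw_M1 : ∀ t ≤ S.T, HasLaw (M1 t) S.lawM1 P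
  hasLaw_Γ : ∀ t ≤ S.T, HasLaw (Γ t) S.lawΓ P
  measurable_X0 : Measurable X0
  measurable_X1 : Measurable X1
  measurable_W0 : ∀ t ≤ S.T, Measurable (W0 t)
  measurable_W1 : ∀ t ≤ S.T, Measurable (W1 t)
  measurable_M0 : ∀ t ≤ S.T, Measurable (M0 t)
  measurable_M1 : ∀ t ≤ S.T, Measurable (M1 t)
  measurable_Γ : ∀ t ≤ S.T, Measurable (Γ t)
  /-- the σ-algebras generated by the primitive random variables are mutually independent -/
  indep : iIndep (fun i : PrimIdx S.T =>
    match i with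
    | .x0 => MeasurableSpace.comap X0 inferInstance
    | .x1 => MeasurableSpace.comap X1 inferInstance
    | .w0 t => MeasurableSpace.comap (W0 t) inferInstance
    | .w1 t => MeasurableSpace.comap (W1 t) inferInstance
    | .m0 t => MeasurableSpace.comap (M0 t) inferInstance
    | .m1 t => MeasurableSpace.comap (M1 t) inferInstance
    | .γ t => MeasurableSpace.comap (Γ t) inferInstance) P

variable {S}

section ClosedLoop

variable {Ω : Type*} [MeasurableSpace Ω] {P : Measure Ω} (N : S.Noise P) (φ : S.Strategy)

/-- The closed loop under `φ`: common information and local state at time `t`. -/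
def traj : (t : ℕ) → Ω → S.Hist t × S.X1
  | 0, ω => (Hist.start (N.X0 ω, N.M0 0 ω, S.channel (N.Γ 0 ω) (N.X1 ω) (N.M1 0 ω)), N.X1 ω)
  | t + 1, ω =>
    let h : S.Hist t := (traj t ω).1
    let x1 : S.X1 := (traj t ω).2
    let u0 : S.U0 := φ.act t h
    let u1 : S.U1 := φ.prs t h (x1, N.M1 t ω)
    let y0 : S.X0 := S.next0 (N.M0 t ω) h.x0 u0 (N.W0 t ω)
    let y1 : S.X1 := S.next1 (N.M0 t ω) (N.M1 t ω) h.x0 x1 u0 u1 (N.W1 t ω)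
    (h.extend u0 (y0, N.M0 (t + 1) ω, S.channel (N.Γ (t + 1) ω) y1 (N.M1 (t + 1) ω)), y1)

/-- Common information at time `t`. -/
def hist (t : ℕ) (ω : Ω) : S.Hist t := (traj N φ t ω).1
/-- Global state at time `t`. -/
def state0 (t : ℕ) (ω : Ω) : S.X0 := (hist N φ t ω).x0
/-- Local state at time `t`. -/
def state1 (t : ℕ) (ω : Ω) : S.X1 := (traj N φ t ω).2
/-- Action of the global controller at time `t`. -/
def ctrl0 (t : ℕ) (ω : Ω) : S.U0 := φ.act t (hist N φ t ω)
/-- Action of the local controller at time `t`. -/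
def ctrl1 (t : ℕ) (ω : Ω) : S.U1 := φ.prs t (hist N φ t ω) (state1 N φ t ω, N.M1 t ω)

/-- Feasible prescription strategies: Borel measurable, with all states and control actions of
finite second moment. -/
structure Feasible : Prop where
  measurable_act : ∀ t ≤ S.T, Measurable (φ.act t)
  measurable_prs : ∀ t ≤ S.T,
    Measurable (fun p : S.Hist t × (S.X1 × S.M1) => φ.prs t p.1 p.2)
  state0_memLp : ∀ t ≤ S.T, MemLp (state0 N φ t) 2 P
  state1_memLp : ∀ t ≤ S.T, MemLp (state1 N φ t) 2 P
  ctrl0_memLp : ∀ t ≤ S.T, MemLp (ctrl0 N φ t) 2 P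
  ctrl1_memLp : ∀ t ≤ S.T, MemLp (ctrl1 N φ t) 2 P

/-- Total expected cost of a prescription strategy. -/
def totalCost : ℝ :=
  ∫ ω, ∑ t ∈ Finset.range (S.T + 1),
    S.cost t (state0 N φ t ω) (state1 N φ t ω) (N.M0 t ω) (N.M1 t ω)
      (ctrl0 N φ t ω) (ctrl1 N φ t ω) ∂P

/-- Optimality for the centralized problem: feasible, and of least total expected cost among all
feasible prescription strategies. -/
def IsOptimal : Prop :=
  Feasible N φ ∧ ∀ φ' : S.Strategy, Feasible N φ' → totalCost N φ ≤ totalCost N φ'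

end ClosedLoop

variable (S)

/-- Law of the local mode given the observed local mode. -/
def modeLaw : Option S.M1 → Measure S.M1
  | none => S.lawM1
  | some m => Measure.dirac m

/-- The belief update `ψ_t(θ, (u0, ρ), x0, m0, z̃, z')`, with `z'` the next channel output for the
local state. -/
def update (t : ℕ) (θ : Measure S.X1) (u0 : S.U0) (ρ : S.X1 × S.M1 → S.U1) (x0 : S.X0) (m0 : S.M0)
    (zt : Option S.M1) : Option S.X1 → Measure S.X1
  | some y => Measure.dirac y
  | none => (θ.prod ((S.modeLaw zt).prod (S.lawW1 t : Measure S.X1))).map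
      (fun p : S.X1 × S.M1 × S.X1 => S.next1 m0 p.2.1 x0 p.1 u0 (ρ (p.1, p.2.1)) p.2.2)

variable {S}

/-- The common belief on the local state at time `t` under `φ`, as a function of the realization of
the common information. -/
def belief (φ : S.Strategy) : (t : ℕ) → S.Hist t → Measure S.X1
  | 0, h => match h.z with
    | some y => Measure.dirac y
    | none => S.lawX1
  | t + 1, h => S.update t (belief φ t h.past) (φ.act t h.past) (φ.prs t h.past)
      h.past.x0 h.past.m0 h.past.zt h.z

variable (S)

/-- Probability measures on the local state space with finite second moment. -/
def Belief : Type :=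
  {θ : Measure S.X1 // IsProbabilityMeasure θ ∧ MemLp id 2 θ}

/-- Value functions: one for each time, of global state, global mode, belief and observed local
mode. -/
abbrev ValueFn : Type := ℕ → S.X0 → S.M0 → S.Belief → Option S.M1 → ℝ

variable {S}

open Classical in
/-- A function of beliefs, extended by `+∞` to measures that are not beliefs. (A prescription for
which the updated measure has infinite second moment also has infinite expected instantaneous cost,
as the matrix `R` is positive definite.) -/
def extendTop (v : S.Belief → ℝ) (θ : Measure S.X1) : EReal :=
  if h : IsProbabilityMeasure θ ∧ MemLp id 2 θ then ((v ⟨θ, h⟩ : ℝ) : EReal) else ⊤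

/-- Expectation of an extended-real function: integral of the positive part minus integral of the
negative part. -/
def eexpect {α : Type*} [MeasurableSpace α] (μ : Measure α) (f : α → EReal) : EReal :=
  ((∫⁻ a, (f a).toENNReal ∂μ : ℝ≥0∞) : EReal) - ((∫⁻ a, (-f a).toENNReal ∂μ : ℝ≥0∞) : EReal)

variable (S)

/-- The joint law, for belief `θ` and observed local mode `zt`, of
`(X¹_t, M¹_t, W⁰_t, W¹_t, M⁰_{t+1}, M¹_{t+1}, Γ_{t+1})`. -/
def stepLaw (t : ℕ) (θ : Measure S.X1) (zt : Option S.M1) :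
    Measure (S.X1 × S.M1 × S.X0 × S.X1 × S.M0 × S.M1 × Bool) :=
  θ.prod ((S.modeLaw zt).prod ((S.lawW0 t : Measure S.X0).prod ((S.lawW1 t : Measure S.X1).prod
    ((S.lawM0 : Measure S.M0).prod ((S.lawM1 : Measure S.M1).prod (S.lawΓ : Measure Bool))))))

/-- The quantity minimized in the dynamic program at time `t`: expected instantaneous cost plus
value at the next time, for the prescription `(u0, ρ)`. -/
def dpObjective (V : S.ValueFn) (t : ℕ) (x0 : S.X0) (m0 : S.M0) (θ : S.Belief) (zt : Option S.M1)
    (u0 : S.U0) (ρ : S.X1 × S.M1 → S.U1) : EReal :=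
  eexpect (S.stepLaw t θ.1 zt) fun (x1, m1, w0, w1, m0', m1', γ') =>
    let u1 : S.U1 := ρ (x1, m1)
    let y0 : S.X0 := S.next0 m0 x0 u0 w0
    let y1 : S.X1 := S.next1 m0 m1 x0 x1 u0 u1 w1
    let o : Option (S.X1 × S.M1) := S.channel γ' y1 m1'
    ((S.cost t x0 x1 m0 m1 u0 u1 : ℝ) : EReal) +
      extendTop (fun θ' => V (t + 1) y0 m0' θ' (o.map Prod.snd))
        (S.update t θ.1 u0 ρ x0 m0 zt (o.map Prod.fst))

/-- `V` satisfies the backward dynamic program; each minimum is over all actions of the global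
controller and all measurable prescriptions, and is attained. -/
structure SolvesDP (V : S.ValueFn) : Prop where
  terminal : ∀ x0 m0 θ zt, V (S.T + 1) x0 m0 θ zt = 0
  step : ∀ t ≤ S.T, ∀ x0 m0 θ zt,
    IsLeast {q : EReal | ∃ (u0 : S.U0) (ρ : S.X1 × S.M1 → S.U1), Measurable ρ ∧
      q = S.dpObjective V t x0 m0 θ zt u0 ρ} ((V t x0 m0 θ zt : ℝ) : EReal)

/-- At every time and for every realization of the common information, with its belief under `φ`,
the prescription chosen by `φ` attains the minimum that defines `V`. -/
def AttainsDP (V : S.ValueFn) (φ : S.Strategy) : Prop :=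
  ∀ t ≤ S.T, ∀ (h : S.Hist t) (θ : S.Belief), θ.1 = belief φ t h →
    S.dpObjective V t h.x0 h.m0 θ h.zt (φ.act t h) (φ.prs t h) =
      ((V t h.x0 h.m0 θ h.zt : ℝ) : EReal)

end SwitchedSystem

end

end NCS

/-!
Conditionally on the past, the channel output either reveals `X¹` or is an erasure that carries no
information, so by Bayes' rule the belief is a regular conditional law of `X¹` given the common
information, whatever the strategy. Hence integrating a cost-to-go that is defined history by
history, from the belief, recovers the expected total cost.

A solution `V` of the dynamic program need not be measurable, so it is never integrated along
trajectories: by backward induction it is compared pointwise, at every history, with the cost-to-go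
of a strategy, from below in general and from above for a strategy that attains the minima. The
value `+∞` outside the square-integrable beliefs does no harm: as `R` is positive definite, a finite
expected stage cost forces the prescription to be square-integrable, and then so is the next belief.
-/

namespace NCS

noncomputable section

section Option

variable {α β γ : Type*} [MeasurableSpace α] [MeasurableSpace β] [MeasurableSpace γ]

theorem measurable_some : Measurable (some : α → Option α) := fun _ hs => hs

theorem measurable_of_some {f : Option α → β} (hf : Measurable fun a => f (some a)) :
    Measurable f := fun _ hs => hf hs

theorem measurable_option_map {f : α → β} (hf : Measurable f) : Measurable (Option.map f) :=
  measurable_of_some (measurable_some.comp hf)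

theorem measurableEmbedding_some : MeasurableEmbedding (some : α → Option α) where
  injective := Option.some_injective α
  measurable := measurable_some
  measurableSet_image' s hs := by
    change MeasurableSet (some ⁻¹' (some '' s))
    rwa [Set.preimage_image_eq _ (Option.some_injective α)]

theorem measurableSet_singleton_none : MeasurableSet ({none} : Set (Option α)) := by
  change MeasurableSet (some ⁻¹' {none})
  convert MeasurableSet.empty
  ext
  simp

theorem measurable_prod_option {f : β × Option α → γ}
    (hs : Measurable fun p : β × α => f (p.1, some p.2))
    (hn : Measurable fun b => f (b, none)) : Measurable f := by
  intro s hs'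
  have h : f ⁻¹' s = Prod.map id some '' ((fun p : β × α => f (p.1, some p.2)) ⁻¹' s) ∪
      ((fun b => f (b, none)) ⁻¹' s) ×ˢ {none} := by
    ext ⟨b, o⟩
    cases o <;> simp
  rw [h]
  exact ((MeasurableEmbedding.id.prodMap measurableEmbedding_some).measurableSet_image.2
    (hs hs')).union ((hn hs').prod measurableSet_singleton_none)

theorem measurable_ite_some {b : α → Bool} {y : α → β} (hb : Measurable b) (hy : Measurable y) :
    Measurable fun a => if b a then some (y a) else none :=
  Measurable.ite (hb (measurableSet_singleton true)) (measurable_some.comp hy) measurable_const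

end Option

section CondDistrib

variable {Ω α β γ δ : Type*} [MeasurableSpace Ω] [MeasurableSpace α] [MeasurableSpace β]
  [MeasurableSpace γ] [MeasurableSpace δ] {P : Measure Ω} {X : Ω → α} {Y : Ω → β} {Z : Ω → γ}
  {κ : Kernel α β}

theorem lintegral_of_hasCondDistrib [SFinite P] [IsSFiniteKernel κ] (hY : HasCondDistrib Y X κ P)
    {f : α × β → ℝ≥0∞} (hf : Measurable f) :
    ∫⁻ ω, f (X ω, Y ω) ∂P = ∫⁻ ω, ∫⁻ y, f (X ω, y) ∂κ (X ω) ∂P := by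
  rw [hY.lintegral_comp hf.aemeasurable, Measure.lintegral_compProd hf,
    lintegral_map' (Measurable.lintegral_kernel_prod_right' hf).aemeasurable hY.aemeasurable_fst]

theorem hasCondDistrib_const [IsFiniteMeasure P] {μ : Measure β} [SFinite μ]
    (hX : AEMeasurable X P) (hY : HasLaw Y μ P) (h : IndepFun X Y P) :
    HasCondDistrib Y X (Kernel.const α μ) P := by
  have hmap : HasLaw X (P.map X) P := ⟨hX, rfl⟩
  have h' := h.hasLaw_prod hmap hY
  rwa [← Measure.compProd_const] at h'

theorem hasCondDistrib_prodMk_of_indepFun [IsFiniteMeasure P] [IsSFiniteKernel κ] {ν : Measure γ}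
    [SFinite ν] (hY : HasCondDistrib Y X κ P) (hZ : HasLaw Z ν P)
    (h : IndepFun (fun ω => (X ω, Y ω)) Z P) :
    HasCondDistrib (fun ω => (Y ω, Z ω)) X (κ ×ₖ Kernel.const α ν) P := by
  have hXY : HasLaw _ (((P.map X) ⊗ₘ κ).prod ν) P := h.hasLaw_prod hY hZ
  have hf : Measurable fun p : (α × β) × γ => (p.1.1, (p.1.2, p.2)) := by fun_prop
  have hX := hY.aemeasurable_fst
  have hY' := hY.aemeasurable_snd
  have hZ' := hZ.aemeasurable
  refine ⟨by fun_prop, ?_⟩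
  calc P.map (fun ω => (X ω, (Y ω, Z ω)))
      = (((P.map X) ⊗ₘ κ).prod ν).map (fun p => (p.1.1, (p.1.2, p.2))) := by
        rw [← hXY.map_eq, AEMeasurable.map_map_of_aemeasurable hf.aemeasurable hXY.aemeasurable]
        rfl
    _ = (P.map X) ⊗ₘ (κ ×ₖ Kernel.const α ν) := by
        refine Measure.ext_of_lintegral _ fun f hfm => ?_
        rw [lintegral_map hfm hf, lintegral_prod _ (by fun_prop),
          Measure.lintegral_compProd (by fun_prop), Measure.lintegral_compProd hfm]
        refine lintegral_congr fun a => ?_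
        rw [Kernel.lintegral_prod _ _ _ (by fun_prop)]
        rfl

theorem hasCondDistrib_prodMk_prodMk_of_indepFun [IsFiniteMeasure P] {W : Ω → δ} {η : Kernel α γ}
    [IsSFiniteKernel κ] [IsSFiniteKernel η] {ν : Measure δ} [SFinite ν]
    (hYZ : HasCondDistrib (fun ω => (Y ω, Z ω)) X (κ ×ₖ η) P) (hW : HasLaw W ν P)
    (h : IndepFun (fun ω => (X ω, Y ω, Z ω)) W P) :
    HasCondDistrib (fun ω => (Y ω, Z ω, W ω)) X (κ ×ₖ (η ×ₖ Kernel.const α ν)) P := by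
  have hYZW := (hasCondDistrib_prodMk_of_indepFun hYZ hW h).comp_left
    MeasurableEquiv.prodAssoc.measurable
  rwa [Kernel.prodAssoc_prod] at hYZW

theorem hasCondDistrib_prodMkRight_of_indepFun [IsFiniteMeasure P] [IsMarkovKernel κ]
    {ν : Measure γ} [SFinite ν] (hY : HasCondDistrib Y X κ P) (hZ : HasLaw Z ν P)
    (h : IndepFun (fun ω => (X ω, Y ω)) Z P) :
    HasCondDistrib Y (fun ω => (X ω, Z ω)) (Kernel.prodMkRight γ κ) P := by
  have hκ : Kernel.const α ν ⊗ₖ Kernel.prodMkRight γ κ =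
      (κ ×ₖ Kernel.const α ν).map Prod.swap := by
    ext a : 1
    refine Measure.ext_of_lintegral _ fun f hf => ?_
    rw [Kernel.lintegral_compProd _ _ _ hf, Kernel.lintegral_map _ measurable_swap _ hf,
      Kernel.lintegral_prod_symm _ _ _ (by fun_prop)]
    rfl
  refine HasCondDistrib.of_compProd (κ := Kernel.const α ν) ?_
  rw [hκ]
  exact (hasCondDistrib_prodMk_of_indepFun hY hZ h).comp_left measurable_swap

theorem hasCondDistrib_map_of_prodMk [SFinite P] [IsSFiniteKernel κ] (hY : HasCondDistrib Y X κ P)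
    {f : α × β → γ} (hf : Measurable f) :
    HasCondDistrib (fun ω => f (X ω, Y ω)) X ((Kernel.id ×ₖ κ).map f) P := by
  have hXf : AEMeasurable (fun ω => (X ω, f (X ω, Y ω))) P :=
    hY.aemeasurable_fst.prodMk (hf.comp_aemeasurable hY.aemeasurable)
  refine ⟨hXf, Measure.ext_of_lintegral _ fun g hg => ?_⟩
  have hgf : Measurable fun p : α × β => g (p.1, f p) := by fun_prop
  rw [lintegral_map' hg.aemeasurable hXf, Measure.lintegral_compProd hg,
    lintegral_map' (Measurable.lintegral_kernel_prod_right' hg).aemeasurable hY.aemeasurable_fst]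
  refine (lintegral_of_hasCondDistrib hY hgf).trans (lintegral_congr fun ω => ?_)
  rw [Kernel.lintegral_map _ hf _ (by fun_prop), Kernel.lintegral_id_prod (by fun_prop)]

/-- The posterior kernel of an erasure channel with side information `a : α`: the input has prior
`κ a`, the output is the input itself or the erasure symbol `none`, which carries no information. -/
def erasurePosterior (κ : Kernel α β) : Kernel (α × Option β) β where
  toFun p := p.2.elim (κ p.1) Measure.dirac
  measurable' := measurable_prod_option (Measure.measurable_dirac.comp measurable_snd) κ.measurable

@[simp]
theorem erasurePosterior_none (κ : Kernel α β) (a : α) : erasurePosterior κ (a, none) = κ a := rfl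

@[simp]
theorem erasurePosterior_some (κ : Kernel α β) (a : α) (b : β) :
    erasurePosterior κ (a, some b) = Measure.dirac b := rfl

instance isMarkovKernel_erasurePosterior [IsMarkovKernel κ] :
    IsMarkovKernel (erasurePosterior κ) := by
  refine ⟨?_⟩
  rintro ⟨a, _ | b⟩
  · exact inferInstanceAs (IsProbabilityMeasure (κ a))
  · exact inferInstanceAs (IsProbabilityMeasure (Measure.dirac b))

theorem compProd_erasurePosterior [IsMarkovKernel κ] (ν : Measure Bool) [SFinite ν] :
    ((κ ×ₖ Kernel.const α ν).map fun p : β × Bool => if p.2 then some p.1 else none) ⊗ₖ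
        erasurePosterior κ =
      (κ ×ₖ Kernel.const α ν).map fun p : β × Bool => (if p.2 then some p.1 else none, p.1) := by
  have he : Measurable fun p : β × Bool => if p.2 then some p.1 else none :=
    measurable_ite_some measurable_snd measurable_fst
  ext a : 1
  refine Measure.ext_of_lintegral _ fun f hf => ?_
  have hF : Measurable fun o => ∫⁻ y, f (o, y) ∂erasurePosterior κ (a, o) :=
    Measurable.lintegral_kernel_prod_right'
      (κ := (erasurePosterior κ).comap (Prod.mk a) (by fun_prop)) hf
  rw [Kernel.lintegral_compProd _ _ _ hf, Kernel.lintegral_map _ he _ hF,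
    Kernel.lintegral_map _ (he.prodMk measurable_fst) _ hf]
  refine (Kernel.lintegral_prod_symm _ _ _ (hF.comp he)).trans (Eq.trans ?_
    (Kernel.lintegral_prod_symm _ _ _ (hf.comp (he.prodMk measurable_fst))).symm)
  refine lintegral_congr fun γ => ?_
  cases γ with
  | false => simp
  | true => exact lintegral_congr fun y => lintegral_dirac' _ (by fun_prop)

theorem hasCondDistrib_erasurePosterior [IsFiniteMeasure P] [IsMarkovKernel κ] {Γ : Ω → Bool}
    {ν : Measure Bool} [SFinite ν] (hY : HasCondDistrib Y X κ P) (hΓ : HasLaw Γ ν P)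
    (h : IndepFun (fun ω => (X ω, Y ω)) Γ P) :
    HasCondDistrib Y (fun ω => (X ω, if Γ ω then some (Y ω) else none)) (erasurePosterior κ) P := by
  refine HasCondDistrib.of_compProd
    (κ := (κ ×ₖ Kernel.const α ν).map fun p : β × Bool => if p.2 then some p.1 else none) ?_
  rw [compProd_erasurePosterior]
  exact (hasCondDistrib_prodMk_of_indepFun hY hΓ h).comp_left
    ((measurable_ite_some measurable_snd measurable_fst).prodMk measurable_fst)

theorem condProb_ae_eq_of_hasCondDistrib [IsFiniteMeasure P] [StandardBorelSpace β] [Nonempty β]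
    [IsFiniteKernel κ] (hX : Measurable X) (hY : Measurable Y) (h : HasCondDistrib Y X κ P)
    {E : Set β} (hE : MeasurableSet E) :
    P⟦Y ⁻¹' E | MeasurableSpace.comap X inferInstance⟧ =ᵐ[P] fun ω => (κ (X ω)).real E := by
  refine (condDistrib_ae_eq_condExp hX hY hE).symm.trans ?_
  filter_upwards [ae_of_ae_map hX.aemeasurable
    (condDistrib_ae_eq_of_measure_eq_compProd X hY.aemeasurable h.map_eq)] with ω hω
  rw [hω]

end CondDistrib

section Vectors

variable {α : Type*} [MeasurableSpace α]

theorem measurable_mulVec {ι m n : Type*} [Finite ι] [MeasurableSpace ι]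
    [MeasurableSingletonClass ι] [Fintype n] (A : ι → Matrix m n ℝ) {i : α → ι} {v : α → n → ℝ}
    (hi : Measurable i) (hv : Measurable v) : Measurable fun a => A (i a) *ᵥ v a := by
  refine measurable_pi_iff.2 fun k => ?_
  simp only [Matrix.mulVec, dotProduct]
  refine Finset.measurable_sum _ fun j _ => ?_
  exact ((measurable_of_finite fun q => A q k j).comp hi).mul ((measurable_pi_apply j).comp hv)

theorem measurable_dotProduct {n : Type*} [Fintype n] {u v : α → n → ℝ}
    (hu : Measurable u) (hv : Measurable v) : Measurable fun a => u a ⬝ᵥ v a := by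
  simp only [dotProduct]
  exact Finset.measurable_sum _ fun j _ =>
    ((measurable_pi_apply j).comp hu).mul ((measurable_pi_apply j).comp hv)

theorem measurable_sumElim {m n : Type*} {u : α → m → ℝ} {v : α → n → ℝ}
    (hu : Measurable u) (hv : Measurable v) : Measurable fun a => Sum.elim (u a) (v a) := by
  refine measurable_pi_iff.2 fun k => ?_
  cases k with
  | inl i => exact (measurable_pi_apply i).comp hu
  | inr i => exact (measurable_pi_apply i).comp hv

theorem measurable_snoc {β : Type*} [MeasurableSpace β] {n : ℕ} {f : α → Fin n → β} {g : α → β}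
    (hf : Measurable f) (hg : Measurable g) :
    Measurable fun a => Fin.snoc (α := fun _ => β) (f a) (g a) := by
  refine measurable_pi_iff.2 fun i => ?_
  induction i using Fin.lastCases with
  | last => simpa using hg
  | cast i => simpa using measurable_pi_iff.1 hf i

theorem exists_norm_sq_le_of_posDef {n : Type*} [Fintype n] {A : Matrix n n ℝ} (hA : A.PosDef) :
    ∃ C, 0 ≤ C ∧ ∀ u : n → ℝ, ‖u‖ ^ 2 ≤ C * (u ⬝ᵥ (A *ᵥ u)) := by
  rcases (Metric.sphere (0 : n → ℝ) 1).eq_empty_or_nonempty with he | hne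
  · refine ⟨0, le_rfl, fun u => ?_⟩
    have hu : u = 0 := by
      by_contra hu
      have : ‖u‖⁻¹ • u ∈ Metric.sphere (0 : n → ℝ) 1 := by
        simp [norm_smul, inv_mul_cancel₀ (norm_ne_zero_iff.2 hu)]
      simp [he] at this
    simp [hu]
  · have hc : Continuous fun u : n → ℝ => u ⬝ᵥ (A *ᵥ u) := by
      simp only [dotProduct, Matrix.mulVec]
      fun_prop
    obtain ⟨v, hv, hmin⟩ := (isCompact_sphere (0 : n → ℝ) 1).exists_isMinOn hne hc.continuousOn
    have hv0 : v ≠ 0 := by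
      rintro rfl
      simp at hv
    have hpos : 0 < v ⬝ᵥ (A *ᵥ v) := by simpa using hA.dotProduct_mulVec_pos hv0
    refine ⟨(v ⬝ᵥ (A *ᵥ v))⁻¹, by positivity, fun u => ?_⟩
    by_cases hu : u = 0
    · simp [hu]
    have hn : 0 < ‖u‖ := norm_pos_iff.2 hu
    have h1 : v ⬝ᵥ (A *ᵥ v) ≤ (‖u‖⁻¹ • u) ⬝ᵥ (A *ᵥ (‖u‖⁻¹ • u)) :=
      hmin (by simp [norm_smul, inv_mul_cancel₀ hn.ne'])
    rw [Matrix.mulVec_smul, smul_dotProduct, dotProduct_smul, smul_eq_mul, smul_eq_mul,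
      ← mul_assoc, ← mul_inv, ← sq, le_inv_mul_iff₀ (by positivity)] at h1
    rwa [le_inv_mul_iff₀ hpos, mul_comm]

theorem quadratic_nonneg {n : Type*} [Fintype n] {A : Matrix n n ℝ} (hA : A.PosSemidef)
    (u : n → ℝ) : 0 ≤ u ⬝ᵥ (A *ᵥ u) := by
  simpa using hA.dotProduct_mulVec_nonneg u

theorem memLp_mulVec {ι m n : Type*} {μ : Measure α} [Finite ι]
    [MeasurableSpace ι] [MeasurableSingletonClass ι] [Fintype m] [Fintype n] (A : ι → Matrix m n ℝ)
    {i : α → ι} {v : α → n → ℝ} (hi : Measurable i) (hvm : Measurable v) (hv : MemLp v 2 μ) :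
    MemLp (fun a => A (i a) *ᵥ v a) 2 μ := by
  have := Fintype.ofFinite ι
  refine hv.of_le_mul (c := ∑ j, ‖(Matrix.mulVecLin (A j)).toContinuousLinearMap‖)
    (measurable_mulVec A hi hvm).aestronglyMeasurable (ae_of_all _ fun a => ?_)
  refine ((Matrix.mulVecLin (A (i a))).toContinuousLinearMap.le_opNorm (v a)).trans ?_
  exact mul_le_mul_of_nonneg_right (Finset.single_le_sum
    (f := fun j => ‖(Matrix.mulVecLin (A j)).toContinuousLinearMap‖)
    (fun _ _ => norm_nonneg _) (Finset.mem_univ (i a))) (norm_nonneg _)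

theorem memLp_sumElim {m n : Type*} {μ : Measure α} [Fintype m] [Fintype n]
    {u : α → m → ℝ} {v : α → n → ℝ} (hu : MemLp u 2 μ) (hv : MemLp v 2 μ) :
    MemLp (fun a => Sum.elim (u a) (v a)) 2 μ := by
  refine MemLp.of_eval fun k => ?_
  cases k with
  | inl i => exact hu.eval i
  | inr i => exact hv.eval i

theorem integrable_quadratic {ι n : Type*} {μ : Measure α} [Finite ι]
    [MeasurableSpace ι] [MeasurableSingletonClass ι] [Fintype n]
    (A : ι → Matrix n n ℝ) {i : α → ι} {v : α → n → ℝ} (hi : Measurable i)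
    (hvm : Measurable v) (hv : MemLp v 2 μ) :
    Integrable (fun a => v a ⬝ᵥ (A (i a) *ᵥ v a)) μ := by
  have hA := memLp_mulVec A hi hvm hv
  simp only [dotProduct]
  exact integrable_finsetSum _ fun j _ => (hv.eval j).integrable_mul (hA.eval j)

end Vectors

namespace SwitchedSystem

variable {S : SwitchedSystem} {α : Type*} [MeasurableSpace α] {t : ℕ}

@[fun_prop]
theorem measurable_next0 {m0 : α → S.M0} {x0 : α → S.X0} {u0 : α → S.U0} {w0 : α → S.X0}
    (hm : Measurable m0) (hx : Measurable x0) (hu : Measurable u0) (hw : Measurable w0) :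
    Measurable fun a => S.next0 (m0 a) (x0 a) (u0 a) (w0 a) :=
  ((measurable_mulVec S.A00 hm hx).add (measurable_mulVec S.B00 hm hu)).add hw

@[fun_prop]
theorem measurable_next1 {m0 : α → S.M0} {m1 : α → S.M1} {x0 : α → S.X0} {x1 : α → S.X1}
    {u0 : α → S.U0} {u1 : α → S.U1} {w1 : α → S.X1} (hm0 : Measurable m0) (hm1 : Measurable m1)
    (hx0 : Measurable x0) (hx1 : Measurable x1) (hu0 : Measurable u0) (hu1 : Measurable u1)
    (hw1 : Measurable w1) :
    Measurable fun a => S.next1 (m0 a) (m1 a) (x0 a) (x1 a) (u0 a) (u1 a) (w1 a) :=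
  ((((measurable_mulVec (fun q : S.M0 × S.M1 => S.A10 q.1 q.2) (hm0.prodMk hm1) hx0).add
    (measurable_mulVec (fun q : S.M0 × S.M1 => S.A11 q.1 q.2) (hm0.prodMk hm1) hx1)).add
    (measurable_mulVec (fun q : S.M0 × S.M1 => S.B10 q.1 q.2) (hm0.prodMk hm1) hu0)).add
    (measurable_mulVec (fun q : S.M0 × S.M1 => S.B11 q.1 q.2) (hm0.prodMk hm1) hu1)).add hw1

@[fun_prop]
theorem measurable_cost {x0 : α → S.X0} {x1 : α → S.X1} {m0 : α → S.M0} {m1 : α → S.M1}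
    {u0 : α → S.U0} {u1 : α → S.U1} (hx0 : Measurable x0) (hx1 : Measurable x1)
    (hm0 : Measurable m0) (hm1 : Measurable m1) (hu0 : Measurable u0) (hu1 : Measurable u1) :
    Measurable fun a => S.cost t (x0 a) (x1 a) (m0 a) (m1 a) (u0 a) (u1 a) := by
  have hx := measurable_sumElim hx0 hx1
  have hu := measurable_sumElim hu0 hu1
  exact (measurable_dotProduct hx (measurable_mulVec (fun q : S.M0 × S.M1 => S.Q t q.1 q.2)
    (hm0.prodMk hm1) hx)).add (measurable_dotProduct hu
      (measurable_mulVec (fun q : S.M0 × S.M1 => S.R t q.1 q.2) (hm0.prodMk hm1) hu))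

@[fun_prop]
theorem measurable_channel {γ : α → Bool} {x1 : α → S.X1} {m1 : α → S.M1} (hγ : Measurable γ)
    (hx : Measurable x1) (hm : Measurable m1) :
    Measurable fun a => S.channel (γ a) (x1 a) (m1 a) :=
  measurable_ite_some hγ (hx.prodMk hm)

namespace Hist

@[fun_prop]
theorem measurable_x0 : Measurable (Hist.x0 : S.Hist t → S.X0) := by
  unfold Hist.x0; fun_prop

@[fun_prop]
theorem measurable_m0 : Measurable (Hist.m0 : S.Hist t → S.M0) := by
  unfold Hist.m0; fun_prop

@[fun_prop]
theorem measurable_z : Measurable (Hist.z : S.Hist t → Option S.X1) :=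
  (measurable_option_map measurable_fst).comp
    (by fun_prop : Measurable fun h : S.Hist t => (h.1 (Fin.last t)).2.2)

@[fun_prop]
theorem measurable_zt : Measurable (Hist.zt : S.Hist t → Option S.M1) :=
  (measurable_option_map measurable_snd).comp
    (by fun_prop : Measurable fun h : S.Hist t => (h.1 (Fin.last t)).2.2)

@[fun_prop]
theorem measurable_past : Measurable (Hist.past : S.Hist (t + 1) → S.Hist t) := by
  unfold Hist.past Fin.init; fun_prop

@[fun_prop]
theorem measurable_start : Measurable (Hist.start : S.Obs → S.Hist 0) := by
  unfold Hist.start; fun_prop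

@[fun_prop]
theorem measurable_extend {h : α → S.Hist t} {u0 : α → S.U0} {o : α → S.Obs}
    (hh : Measurable h) (hu : Measurable u0) (ho : Measurable o) :
    Measurable fun a => (h a).extend (u0 a) (o a) :=
  (measurable_snoc hh.fst ho).prodMk (measurable_snoc hh.snd hu)

@[simp]
theorem past_extend (h : S.Hist t) (u0 : S.U0) (o : S.Obs) : (h.extend u0 o).past = h := by
  simp [past, extend]

@[simp]
theorem x0_extend (h : S.Hist t) (u0 : S.U0) (o : S.Obs) : (h.extend u0 o).x0 = o.1 := by
  simp [x0, extend]

@[simp]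
theorem m0_extend (h : S.Hist t) (u0 : S.U0) (o : S.Obs) : (h.extend u0 o).m0 = o.2.1 := by
  simp [m0, extend]

@[simp]
theorem z_extend (h : S.Hist t) (u0 : S.U0) (o : S.Obs) :
    (h.extend u0 o).z = o.2.2.map Prod.fst := by
  simp [z, extend]

@[simp]
theorem zt_extend (h : S.Hist t) (u0 : S.U0) (o : S.Obs) :
    (h.extend u0 o).zt = o.2.2.map Prod.snd := by
  simp [zt, extend]

end Hist

/-- Borel measurability of a prescription strategy up to the horizon: feasibility without the
moment conditions. -/
structure Strategy.IsMeasurable (φ : S.Strategy) : Prop where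
  act : ∀ t ≤ S.T, Measurable (φ.act t)
  prs : ∀ t ≤ S.T, Measurable (fun p : S.Hist t × (S.X1 × S.M1) => φ.prs t p.1 p.2)

theorem Feasible.isMeasurable {Ω : Type*} [MeasurableSpace Ω] {P : Measure Ω} {N : S.Noise P}
    {φ : S.Strategy} (h : Feasible N φ) : φ.IsMeasurable := ⟨h.measurable_act, h.measurable_prs⟩

variable {φ : S.Strategy}

theorem Strategy.IsMeasurable.prs_apply (hφ : φ.IsMeasurable) (ht : t ≤ S.T) (h : S.Hist t) :
    Measurable (φ.prs t h) :=
  (hφ.prs t ht).comp measurable_prodMk_left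

instance isProbabilityMeasure_modeLaw (zt : Option S.M1) :
    IsProbabilityMeasure (S.modeLaw zt) := by
  cases zt <;> (simp only [modeLaw]; infer_instance)

theorem measurable_modeLaw : Measurable S.modeLaw :=
  measurable_of_some Measure.measurable_dirac

/-- The law of the local mode given the common information, as a kernel. -/
def modeKernel (S : SwitchedSystem) (t : ℕ) : Kernel (S.Hist t) S.M1 :=
  ⟨fun h => S.modeLaw h.zt, measurable_modeLaw.comp Hist.measurable_zt⟩

instance isMarkovKernel_modeKernel (t : ℕ) : IsMarkovKernel (S.modeKernel t) :=
  ⟨fun h => isProbabilityMeasure_modeLaw h.zt⟩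

/-- The local state one step after the common information `h`, local state `p.1`, local mode
`p.2.1` and local noise `p.2.2`. -/
def nextLocal (φ : S.Strategy) (t : ℕ) (h : S.Hist t) (p : S.X1 × S.M1 × S.X1) : S.X1 :=
  S.next1 h.m0 p.2.1 h.x0 p.1 (φ.act t h) (φ.prs t h (p.1, p.2.1)) p.2.2

theorem measurable_nextLocal (hφ : φ.IsMeasurable) (ht : t ≤ S.T) :
    Measurable fun q : S.Hist t × S.X1 × S.M1 × S.X1 => nextLocal φ t q.1 q.2 := by
  have ha := hφ.act t ht
  have hp : Measurable fun q : S.Hist t × S.X1 × S.M1 × S.X1 => φ.prs t q.1 (q.2.1, q.2.2.1) :=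
    (hφ.prs t ht).comp (measurable_fst.prodMk (measurable_snd.fst.prodMk measurable_snd.snd.fst))
  unfold nextLocal
  fun_prop

/-- The law of the next local state given the common information, when `κ` is the law of the
current one: the belief update before the next channel output is received. -/
def predictKernel (φ : S.Strategy) (t : ℕ) (κ : Kernel (S.Hist t) S.X1) :
    Kernel (S.Hist t) S.X1 :=
  (Kernel.id ×ₖ (κ ×ₖ (S.modeKernel t ×ₖ Kernel.const _ (S.lawW1 t : Measure S.X1)))).map
    fun q => nextLocal φ t q.1 q.2

theorem isMarkovKernel_predictKernel (hφ : φ.IsMeasurable) (ht : t ≤ S.T)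
    (κ : Kernel (S.Hist t) S.X1) [IsMarkovKernel κ] : IsMarkovKernel (predictKernel φ t κ) :=
  Kernel.IsMarkovKernel.map _ (measurable_nextLocal hφ ht)

theorem predictKernel_apply (hφ : φ.IsMeasurable) (ht : t ≤ S.T) (κ : Kernel (S.Hist t) S.X1)
    [IsSFiniteKernel κ] (h : S.Hist t) :
    predictKernel φ t κ h =
      S.update t (κ h) (φ.act t h) (φ.prs t h) h.x0 h.m0 h.zt none := by
  have hn := measurable_nextLocal hφ ht
  rw [predictKernel, Kernel.map_apply _ hn, Kernel.prod_apply, Kernel.id_apply,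
    Measure.dirac_prod, Measure.map_map hn measurable_prodMk_left, Kernel.prod_apply,
    Kernel.prod_apply, Kernel.const_apply]
  rfl

theorem belief_zero (φ : S.Strategy) (h : S.Hist 0) :
    belief φ 0 h = erasurePosterior (Kernel.const Unit (S.lawX1 : Measure S.X1)) ((), h.z) := by
  rw [belief]
  split <;> simp [*]

theorem belief_succ (hφ : φ.IsMeasurable) (ht : t ≤ S.T) {κ : Kernel (S.Hist t) S.X1}
    [IsSFiniteKernel κ] (hκ : ⇑κ = belief φ t) (h : S.Hist (t + 1)) :
    belief φ (t + 1) h = erasurePosterior (predictKernel φ t κ) (h.past, h.z) := by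
  rw [belief, ← hκ]
  cases h.z with
  | none => rw [erasurePosterior_none, predictKernel_apply hφ ht]
  | some y => rfl

theorem exists_markovKernel_belief (hφ : φ.IsMeasurable) (ht : t ≤ S.T + 1) :
    ∃ κ : Kernel (S.Hist t) S.X1, IsMarkovKernel κ ∧ ⇑κ = belief φ t := by
  induction t with
  | zero =>
    have hz : Measurable fun h : S.Hist 0 => ((), h.z) := by fun_prop
    exact ⟨(erasurePosterior (Kernel.const Unit (S.lawX1 : Measure S.X1))).comap _ hz,
      inferInstance, funext fun h => (belief_zero φ h).symm⟩
  | succ t ih =>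
    obtain ⟨κ, hκM, hκ⟩ := ih (by omega)
    have := isMarkovKernel_predictKernel hφ (by omega) κ
    have hz : Measurable fun h : S.Hist (t + 1) => (h.past, h.z) := by fun_prop
    exact ⟨(erasurePosterior (predictKernel φ t κ)).comap _ hz,
      inferInstance, funext fun h => (belief_succ hφ (by omega) hκ h).symm⟩

theorem measurable_belief (hφ : φ.IsMeasurable) (ht : t ≤ S.T + 1) : Measurable (belief φ t) := by
  obtain ⟨κ, -, hκ⟩ := exists_markovKernel_belief hφ ht
  exact hκ ▸ κ.measurable

theorem isProbabilityMeasure_belief (hφ : φ.IsMeasurable) (ht : t ≤ S.T + 1) (h : S.Hist t) :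
    IsProbabilityMeasure (belief φ t h) := by
  obtain ⟨κ, hκM, hκ⟩ := exists_markovKernel_belief hφ ht
  exact hκ ▸ hκM.isProbabilityMeasure h

/-- The belief on the local state given the common information, as a kernel. -/
def beliefKernel (hφ : φ.IsMeasurable) (ht : t ≤ S.T + 1) : Kernel (S.Hist t) S.X1 :=
  ⟨belief φ t, measurable_belief hφ ht⟩

instance isMarkovKernel_beliefKernel (hφ : φ.IsMeasurable) (ht : t ≤ S.T + 1) :
    IsMarkovKernel (beliefKernel hφ ht) :=
  ⟨isProbabilityMeasure_belief hφ ht⟩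

theorem beliefKernel_apply (hφ : φ.IsMeasurable) (ht : t ≤ S.T + 1) (h : S.Hist t) :
    beliefKernel hφ ht h = belief φ t h := rfl

theorem modeKernel_apply (h : S.Hist t) : S.modeKernel t h = S.modeLaw h.zt := rfl

theorem belief_extend (φ : S.Strategy) (h : S.Hist t) (u0 : S.U0) (o : S.Obs) :
    belief φ (t + 1) (h.extend u0 o) = S.update t (belief φ t h) (φ.act t h) (φ.prs t h)
      h.x0 h.m0 h.zt (o.2.2.map Prod.fst) := by
  simp only [belief, Hist.past_extend, Hist.z_extend]

/-- The noises at time `t` together with the modes and the link state at time `t + 1`. -/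
abbrev Innov (S : SwitchedSystem) : Type := S.X0 × S.X1 × S.M0 × S.M1 × Bool

/-- The joint law of the noises at time `t` and the modes and the link state at time `t + 1`. -/
def innovLaw (S : SwitchedSystem) (t : ℕ) : Measure S.Innov :=
  (S.lawW0 t : Measure S.X0).prod ((S.lawW1 t : Measure S.X1).prod
    ((S.lawM0 : Measure S.M0).prod ((S.lawM1 : Measure S.M1).prod (S.lawΓ : Measure Bool))))

instance isProbabilityMeasure_innovLaw (t : ℕ) : IsProbabilityMeasure (S.innovLaw t) := by
  unfold innovLaw; infer_instance

/-- The law of a whole step given the common information, as a kernel. -/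
def stepKernel (hφ : φ.IsMeasurable) (ht : t ≤ S.T + 1) :
    Kernel (S.Hist t) (S.X1 × S.M1 × S.Innov) :=
  beliefKernel hφ ht ×ₖ (S.modeKernel t ×ₖ Kernel.const _ (S.innovLaw t))

instance isMarkovKernel_stepKernel (hφ : φ.IsMeasurable) (ht : t ≤ S.T + 1) :
    IsMarkovKernel (stepKernel hφ ht) := by
  unfold stepKernel; infer_instance

theorem stepKernel_apply (hφ : φ.IsMeasurable) (ht : t ≤ S.T + 1) (h : S.Hist t) :
    stepKernel hφ ht h = S.stepLaw t (belief φ t h) h.zt := by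
  simp only [stepKernel, Kernel.prod_apply, Kernel.const_apply]
  rfl

/-- The common information one step after the common information `h`. -/
def nextHist (φ : S.Strategy) (t : ℕ) (h : S.Hist t) (p : S.X1 × S.M1 × S.Innov) :
    S.Hist (t + 1) :=
  h.extend (φ.act t h) (S.next0 h.m0 h.x0 (φ.act t h) p.2.2.1, p.2.2.2.2.1,
    S.channel p.2.2.2.2.2.2 (nextLocal φ t h (p.1, p.2.1, p.2.2.2.1)) p.2.2.2.2.2.1)

theorem measurable_nextHist (hφ : φ.IsMeasurable) (ht : t ≤ S.T) :
    Measurable fun q : S.Hist t × S.X1 × S.M1 × S.Innov => nextHist φ t q.1 q.2 := by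
  have hq : Measurable fun q : S.Hist t × S.X1 × S.M1 × S.Innov =>
      (q.1, q.2.1, q.2.2.1, q.2.2.2.2.1) := by fun_prop
  have hn := (measurable_nextLocal hφ ht).comp hq
  have ha : Measurable fun q : S.Hist t × S.X1 × S.M1 × S.Innov => φ.act t q.1 :=
    (hφ.act t ht).comp measurable_fst
  refine Hist.measurable_extend measurable_fst ha (Measurable.prodMk ?_ (Measurable.prodMk ?_ ?_))
  · exact measurable_next0 (by fun_prop) (by fun_prop) ha (by fun_prop)
  · fun_prop
  · exact measurable_channel (by fun_prop) hn (by fun_prop)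

/-- The first time at which the common information or the local state can depend on a primitive
random variable. -/
def PrimIdx.time {T : ℕ} : PrimIdx T → ℕ
  | .x0 => 0
  | .x1 => 0
  | .w0 t => t + 1
  | .w1 t => t + 1
  | .m0 t => t
  | .m1 t => t
  | .γ t => t

section Noise

variable {Ω : Type*} [mΩ : MeasurableSpace Ω] {P : Measure Ω}

/-- The σ-algebra generated by a primitive random variable. -/
@[reducible]
def Noise.sigma (N : S.Noise P) : PrimIdx S.T → MeasurableSpace Ω
  | .x0 => MeasurableSpace.comap N.X0 inferInstance
  | .x1 => MeasurableSpace.comap N.X1 inferInstance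
  | .w0 t => MeasurableSpace.comap (N.W0 t) inferInstance
  | .w1 t => MeasurableSpace.comap (N.W1 t) inferInstance
  | .m0 t => MeasurableSpace.comap (N.M0 t) inferInstance
  | .m1 t => MeasurableSpace.comap (N.M1 t) inferInstance
  | .γ t => MeasurableSpace.comap (N.Γ t) inferInstance

theorem Noise.iIndep_sigma (N : S.Noise P) : iIndep N.sigma P := by
  exact N.indep

theorem Noise.sigma_le (N : S.Noise P) (i : PrimIdx S.T) : N.sigma i ≤ mΩ := by
  cases i with
  | x0 => exact N.measurable_X0.comap_le
  | x1 => exact N.measurable_X1.comap_le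
  | w0 t => exact (N.measurable_W0 t (by omega)).comap_le
  | w1 t => exact (N.measurable_W1 t (by omega)).comap_le
  | m0 t => exact (N.measurable_M0 t (by omega)).comap_le
  | m1 t => exact (N.measurable_M1 t (by omega)).comap_le
  | γ t => exact (N.measurable_Γ t (by omega)).comap_le

/-- The σ-algebra generated by a set of primitive random variables. -/
@[reducible]
def Noise.sigmaOf (N : S.Noise P) (A : Set (PrimIdx S.T)) : MeasurableSpace Ω :=
  ⨆ i ∈ A, N.sigma i

theorem Noise.sigmaOf_le (N : S.Noise P) (A : Set (PrimIdx S.T)) : N.sigmaOf A ≤ mΩ :=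
  iSup₂_le fun i _ => N.sigma_le i

theorem Noise.measurable_of_mem (N : S.Noise P) {A : Set (PrimIdx S.T)} {β : Type*}
    [mβ : MeasurableSpace β] {Y : Ω → β} (i : PrimIdx S.T) (hi : i ∈ A)
    (hY : N.sigma i = MeasurableSpace.comap Y mβ) : Measurable[N.sigmaOf A] Y :=
  measurable_iff_comap_le.2 (hY ▸ le_iSup₂_of_le i hi le_rfl)

theorem Noise.indepFun_compl (N : S.Noise P) {A : Set (PrimIdx S.T)} {β γ : Type*}
    [MeasurableSpace β] [MeasurableSpace γ] {Y : Ω → β} {Z : Ω → γ}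
    (hY : Measurable[N.sigmaOf Aᶜ] Y) (hZ : Measurable[N.sigmaOf A] Z) : IndepFun Y Z P :=
  (IndepFun_iff_Indep ..).2 <| indep_of_indep_of_le_left (indep_of_indep_of_le_right
    (indep_iSup_of_disjoint N.sigma_le N.iIndep_sigma disjoint_compl_left) hZ.comap_le) hY.comap_le

variable (N : S.Noise P)

/-- The realized innovation: the fresh randomness that drives the step from `t` to `t + 1`. -/
def innov (t : ℕ) (ω : Ω) : S.Innov :=
  (N.W0 t ω, N.W1 t ω, N.M0 (t + 1) ω, N.M1 (t + 1) ω, N.Γ (t + 1) ω)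

theorem measurable_innov (ht : t < S.T) {A : Set (PrimIdx S.T)}
    (hA : ∀ i : PrimIdx S.T, i.time = t + 1 → i ∈ A) : Measurable[N.sigmaOf A] (innov N t) :=
  (N.measurable_of_mem (.w0 ⟨t, by omega⟩) (hA _ rfl) rfl).prodMk
    ((N.measurable_of_mem (.w1 ⟨t, by omega⟩) (hA _ rfl) rfl).prodMk
    ((N.measurable_of_mem (.m0 ⟨t + 1, by omega⟩) (hA _ rfl) rfl).prodMk
    ((N.measurable_of_mem (.m1 ⟨t + 1, by omega⟩) (hA _ rfl) rfl).prodMk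
    (N.measurable_of_mem (.γ ⟨t + 1, by omega⟩) (hA _ rfl) rfl))))

theorem hasLaw_innov [IsProbabilityMeasure P] (ht : t < S.T) :
    HasLaw (innov N t) (S.innovLaw t) P := by
  have ht' : t + 1 ≤ S.T := ht
  have hw0 {A : Set (PrimIdx S.T)} (h : .w0 ⟨t, by omega⟩ ∈ A) := N.measurable_of_mem _ h rfl
  have hw1 {A : Set (PrimIdx S.T)} (h : .w1 ⟨t, by omega⟩ ∈ A) := N.measurable_of_mem _ h rfl
  have hm0 {A : Set (PrimIdx S.T)} (h : .m0 ⟨t + 1, by omega⟩ ∈ A) := N.measurable_of_mem _ h rfl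
  have hm1 {A : Set (PrimIdx S.T)} (h : .m1 ⟨t + 1, by omega⟩ ∈ A) := N.measurable_of_mem _ h rfl
  have hγ {A : Set (PrimIdx S.T)} (h : .γ ⟨t + 1, by omega⟩ ∈ A) := N.measurable_of_mem _ h rfl
  have h₁ : HasLaw (fun ω => (N.M1 (t + 1) ω, N.Γ (t + 1) ω)) _ P :=
    (N.indepFun_compl (hγ (by simp)) (hm1 (Set.mem_singleton _))).symm.hasLaw_prod
      (N.hasLaw_M1 _ ht') (N.hasLaw_Γ _ ht')
  have h₂ : HasLaw (fun ω => (N.M0 (t + 1) ω, N.M1 (t + 1) ω, N.Γ (t + 1) ω)) _ P :=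
    (N.indepFun_compl ((hm1 (by simp)).prodMk (hγ (by simp)))
      (hm0 (Set.mem_singleton _))).symm.hasLaw_prod (N.hasLaw_M0 _ ht') h₁
  have h₃ : HasLaw (fun ω => (N.W1 t ω, N.M0 (t + 1) ω, N.M1 (t + 1) ω, N.Γ (t + 1) ω)) _ P :=
    (N.indepFun_compl ((hm0 (by simp)).prodMk ((hm1 (by simp)).prodMk (hγ (by simp))))
      (hw1 (Set.mem_singleton _))).symm.hasLaw_prod (N.hasLaw_W1 _ ht.le) h₂
  exact (N.indepFun_compl ((hw1 (by simp)).prodMk ((hm0 (by simp)).prodMk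
    ((hm1 (by simp)).prodMk (hγ (by simp))))) (hw0 (Set.mem_singleton _))).symm.hasLaw_prod
      (N.hasLaw_W0 _ ht.le) h₃

variable (φ)

theorem m0_hist (t : ℕ) (ω : Ω) : (hist N φ t ω).m0 = N.M0 t ω := by
  cases t with
  | zero => rfl
  | succ t => simp [hist, traj]

theorem hist_succ (t : ℕ) (ω : Ω) : hist N φ (t + 1) ω =
    nextHist φ t (hist N φ t ω) (state1 N φ t ω, N.M1 t ω, innov N t ω) := by
  simp only [nextHist, nextLocal, m0_hist]
  rfl

theorem state1_succ (t : ℕ) (ω : Ω) : state1 N φ (t + 1) ω =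
    nextLocal φ t (hist N φ t ω) (state1 N φ t ω, N.M1 t ω, N.W1 t ω) := by
  simp only [nextLocal, m0_hist]
  rfl

variable {φ}

theorem measurable_hist_state1_M1 (hφ : φ.IsMeasurable) (ht : t ≤ S.T) {A : Set (PrimIdx S.T)}
    (hA : ∀ i ∉ A, t < i.time) :
    Measurable[N.sigmaOf A] fun ω => (hist N φ t ω, state1 N φ t ω, N.M1 t ω) := by
  have hA' : ∀ i : PrimIdx S.T, i.time ≤ t → i ∈ A := fun i hi =>
    by_contra fun h => (hA i h).not_ge hi
  have hM0 := N.measurable_of_mem (.m0 ⟨t, by omega⟩) (hA' _ le_rfl) rfl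
  have hM1 := N.measurable_of_mem (.m1 ⟨t, by omega⟩) (hA' _ le_rfl) rfl
  have hΓ := N.measurable_of_mem (.γ ⟨t, by omega⟩) (hA' _ le_rfl) rfl
  induction t with
  | zero =>
    have hX0 := N.measurable_of_mem .x0 (hA' _ le_rfl) rfl
    have hX1 := N.measurable_of_mem .x1 (hA' _ le_rfl) rfl
    have hZ := (measurable_channel (S := S) measurable_fst measurable_snd.fst
      measurable_snd.snd).comp (hΓ.prodMk (hX1.prodMk hM1))
    exact (Hist.measurable_start.comp (hX0.prodMk (hM0.prodMk hZ))).prodMk (hX1.prodMk hM1)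
  | succ t ih =>
    have hp := ih (by omega) (fun i hi => (Nat.lt_succ_self t).trans (hA i hi))
      (fun i hi => hA' i (hi.trans (Nat.le_succ t)))
      (N.measurable_of_mem (.m0 ⟨t, by omega⟩) (hA' _ (Nat.le_succ t)) rfl)
      (N.measurable_of_mem (.m1 ⟨t, by omega⟩) (hA' _ (Nat.le_succ t)) rfl)
      (N.measurable_of_mem (.γ ⟨t, by omega⟩) (hA' _ (Nat.le_succ t)) rfl)
    have hI := measurable_innov N (by omega) fun i hi => hA' i hi.le
    have hh := (measurable_nextHist hφ (by omega)).comp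
      (hp.fst.prodMk (hp.snd.fst.prodMk (hp.snd.snd.prodMk hI)))
    have hs := (measurable_nextLocal hφ (by omega)).comp
      (hp.fst.prodMk (hp.snd.fst.prodMk (hp.snd.snd.prodMk hI.snd.fst)))
    have hhs := hh.prodMk (hs.prodMk hM1)
    simp only [hist_succ, state1_succ]
    exact hhs

theorem measurable_hist_state1_succ (hφ : φ.IsMeasurable) (ht : t ≤ S.T)
    {A : Set (PrimIdx S.T)} (hA : ∀ i ∉ A, t < i.time)
    (hw : .w1 ⟨t, by omega⟩ ∈ A) :
    Measurable[N.sigmaOf A] fun ω => (hist N φ t ω, state1 N φ (t + 1) ω) := by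
  have hp := measurable_hist_state1_M1 N hφ ht hA
  have hW1 := N.measurable_of_mem _ hw rfl
  have hs := (measurable_nextLocal hφ ht).comp
    (hp.fst.prodMk (hp.snd.fst.prodMk (hp.snd.snd.prodMk hW1)))
  simp only [state1_succ]
  exact hp.fst.prodMk hs

theorem measurable_hist (hφ : φ.IsMeasurable) (ht : t ≤ S.T) : Measurable (hist N φ t) :=
  ((measurable_hist_state1_M1 N hφ ht fun _ hi => (hi trivial).elim).mono
    (N.sigmaOf_le _) le_rfl).fst

theorem measurable_state1 (hφ : φ.IsMeasurable) (ht : t ≤ S.T) : Measurable (state1 N φ t) :=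
  ((measurable_hist_state1_M1 N hφ ht fun _ hi => (hi trivial).elim).mono
    (N.sigmaOf_le _) le_rfl).snd.fst

theorem erasurePosterior_prod_modeLaw {ι : Type*} [MeasurableSpace ι] (κ : Kernel ι S.X1)
    [IsSFiniteKernel κ] (a : ι) (o : Option (S.X1 × S.M1)) :
    erasurePosterior (κ ×ₖ Kernel.const ι (S.lawM1 : Measure S.M1)) (a, o) =
      (erasurePosterior κ (a, o.map Prod.fst)).prod (S.modeLaw (o.map Prod.snd)) := by
  cases o with
  | none => exact Kernel.prod_apply ..
  | some y => exact Measure.dirac_prod_dirac.symm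

variable [IsProbabilityMeasure P]

theorem hasCondDistrib_state1_M1_zero (hφ : φ.IsMeasurable) :
    HasCondDistrib (fun ω => (state1 N φ 0 ω, N.M1 0 ω)) (hist N φ 0)
      (beliefKernel hφ (Nat.zero_le _) ×ₖ S.modeKernel 0) P := by
  have hX0 {A : Set (PrimIdx S.T)} (h : .x0 ∈ A) := N.measurable_of_mem _ h rfl
  have hX1 {A : Set (PrimIdx S.T)} (h : .x1 ∈ A) := N.measurable_of_mem _ h rfl
  have hM0 {A : Set (PrimIdx S.T)} (h : .m0 ⟨0, by omega⟩ ∈ A) := N.measurable_of_mem _ h rfl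
  have hM1 {A : Set (PrimIdx S.T)} (h : .m1 ⟨0, by omega⟩ ∈ A) := N.measurable_of_mem _ h rfl
  have hΓ {A : Set (PrimIdx S.T)} (h : .γ ⟨0, by omega⟩ ∈ A) := N.measurable_of_mem _ h rfl
  have hlaw : HasLaw (fun ω => (N.X1 ω, N.M1 0 ω)) _ P :=
    (N.indepFun_compl (A := {.m1 ⟨0, by omega⟩}) (hX1 (by simp)) (hM1 (by simp))).hasLaw_prod
      N.hasLaw_X1 (N.hasLaw_M1 0 (Nat.zero_le _))
  have hprior : HasCondDistrib (fun ω => (N.X1 ω, N.M1 0 ω)) (fun ω => (N.X0 ω, N.M0 0 ω)) _ P :=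
    hasCondDistrib_const (N.measurable_X0.prodMk (N.measurable_M0 0 (Nat.zero_le _))).aemeasurable
      hlaw (N.indepFun_compl (A := {.x1, .m1 ⟨0, by omega⟩})
        ((hX0 (by simp)).prodMk (hM0 (by simp))) ((hX1 (by simp)).prodMk (hM1 (by simp))))
  have hpost := hasCondDistrib_erasurePosterior hprior (N.hasLaw_Γ 0 (Nat.zero_le _))
    (N.indepFun_compl (A := {.γ ⟨0, by omega⟩}) (((hX0 (by simp)).prodMk (hM0 (by simp))).prodMk
      ((hX1 (by simp)).prodMk (hM1 (by simp)))) (hΓ (by simp)))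
  rw [← Kernel.prod_const] at hpost
  have hf : Measurable fun q : (S.X0 × S.M0) × Option (S.X1 × S.M1) =>
    Hist.start (S := S) (q.1.1, q.1.2, q.2) := by fun_prop
  have hκ : (beliefKernel hφ (Nat.zero_le _) ×ₖ S.modeKernel 0).comap _ hf =
      erasurePosterior (Kernel.const _ (S.lawX1 : Measure S.X1) ×ₖ Kernel.const _ S.lawM1) := by
    ext q : 1
    rw [Kernel.comap_apply, Kernel.prod_apply, beliefKernel_apply, belief_zero,
      erasurePosterior_prod_modeLaw]
    rfl
  exact HasCondDistrib.comp_right (hf := hf) (hκ ▸ hpost)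

theorem hasCondDistrib_state1_succ (hφ : φ.IsMeasurable) (ht : t ≤ S.T)
    (h : HasCondDistrib (fun ω => (state1 N φ t ω, N.M1 t ω)) (hist N φ t)
      (beliefKernel hφ (by omega) ×ₖ S.modeKernel t) P) :
    HasCondDistrib (state1 N φ (t + 1)) (hist N φ t)
      (predictKernel φ t (beliefKernel hφ (by omega))) P := by
  have hW := hasCondDistrib_prodMk_prodMk_of_indepFun h (N.hasLaw_W1 t ht)
    (N.indepFun_compl (A := {.w1 ⟨t, by omega⟩})
      (measurable_hist_state1_M1 N hφ ht (by simp [PrimIdx.time]))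
      (N.measurable_of_mem _ (Set.mem_singleton _) rfl))
  rw [funext (state1_succ φ N t)]
  exact hasCondDistrib_map_of_prodMk hW (measurable_nextLocal hφ ht)

theorem hasCondDistrib_state1_M1_succ_hist_W0_M0 (hφ : φ.IsMeasurable) (ht : t < S.T)
    (h : HasCondDistrib (fun ω => (state1 N φ t ω, N.M1 t ω)) (hist N φ t)
      (beliefKernel hφ (by omega) ×ₖ S.modeKernel t) P) :
    HasCondDistrib (fun ω => (state1 N φ (t + 1) ω, N.M1 (t + 1) ω))
      (fun ω => (hist N φ t ω, N.W0 t ω, N.M0 (t + 1) ω))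
      (Kernel.prodMkRight (S.X0 × S.M0) (predictKernel φ t (beliefKernel hφ (by omega)) ×ₖ
        Kernel.const _ (S.lawM1 : Measure S.M1))) P := by
  have := isMarkovKernel_predictKernel hφ ht.le (beliefKernel hφ (by omega))
  have h0 : t < S.T + 1 := by omega
  have h1 : t + 1 < S.T + 1 := by omega
  have hW0 {A : Set (PrimIdx S.T)} (h : .w0 ⟨t, h0⟩ ∈ A) := N.measurable_of_mem _ h rfl
  have hM0 {A : Set (PrimIdx S.T)} (h : .m0 ⟨t + 1, h1⟩ ∈ A) := N.measurable_of_mem _ h rfl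
  have hM1 {A : Set (PrimIdx S.T)} (h : .m1 ⟨t + 1, h1⟩ ∈ A) := N.measurable_of_mem _ h rfl
  have hM := hasCondDistrib_prodMk_of_indepFun (hasCondDistrib_state1_succ N hφ ht.le h)
    (N.hasLaw_M1 (t + 1) ht) (N.indepFun_compl (A := {.m1 ⟨t + 1, h1⟩})
      (measurable_hist_state1_succ N hφ ht.le (by simp [PrimIdx.time]) (by simp)) (hM1 (by simp)))
  have hlaw : HasLaw (fun ω => (N.W0 t ω, N.M0 (t + 1) ω)) _ P :=
    (N.indepFun_compl (A := {.m0 ⟨t + 1, h1⟩}) (hW0 (by simp)) (hM0 (by simp))).hasLaw_prod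
      (N.hasLaw_W0 t ht.le) (N.hasLaw_M0 (t + 1) ht)
  have hpast := measurable_hist_state1_succ N hφ ht.le
    (A := {.w0 ⟨t, h0⟩, .m0 ⟨t + 1, h1⟩}ᶜ)
    (by simp [PrimIdx.time, ← or_iff_not_imp_left]) (by simp)
  exact hasCondDistrib_prodMkRight_of_indepFun hM hlaw (N.indepFun_compl
    (hpast.fst.prodMk (hpast.snd.prodMk (hM1 (by simp))))
    ((hW0 (by simp)).prodMk (hM0 (by simp))))

theorem hasCondDistrib_state1_M1_succ (hφ : φ.IsMeasurable) (ht : t < S.T)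
    (h : HasCondDistrib (fun ω => (state1 N φ t ω, N.M1 t ω)) (hist N φ t)
      (beliefKernel hφ (by omega) ×ₖ S.modeKernel t) P) :
    HasCondDistrib (fun ω => (state1 N φ (t + 1) ω, N.M1 (t + 1) ω)) (hist N φ (t + 1))
      (beliefKernel hφ (by omega) ×ₖ S.modeKernel (t + 1)) P := by
  have := isMarkovKernel_predictKernel hφ ht.le (beliefKernel hφ (by omega))
  have h0 : t < S.T + 1 := by omega
  have h1 : t + 1 < S.T + 1 := by omega
  have hW0 {A : Set (PrimIdx S.T)} (h : .w0 ⟨t, h0⟩ ∈ A) := N.measurable_of_mem _ h rfl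
  have hM0 {A : Set (PrimIdx S.T)} (h : .m0 ⟨t + 1, h1⟩ ∈ A) := N.measurable_of_mem _ h rfl
  have hM1 {A : Set (PrimIdx S.T)} (h : .m1 ⟨t + 1, h1⟩ ∈ A) := N.measurable_of_mem _ h rfl
  have hΓ {A : Set (PrimIdx S.T)} (h : .γ ⟨t + 1, h1⟩ ∈ A) := N.measurable_of_mem _ h rfl
  have hpast := measurable_hist_state1_succ N hφ ht.le
    (A := {.γ ⟨t + 1, h1⟩}ᶜ) (by simp [PrimIdx.time]) (by simp)
  have hpost := hasCondDistrib_erasurePosterior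
    (hasCondDistrib_state1_M1_succ_hist_W0_M0 N hφ ht h) (N.hasLaw_Γ (t + 1) ht)
    (N.indepFun_compl ((hpast.fst.prodMk ((hW0 (by simp)).prodMk (hM0 (by simp)))).prodMk
      (hpast.snd.prodMk (hM1 (by simp)))) (hΓ (by simp)))
  have ha := hφ.act t ht.le
  have hf : Measurable fun q : (S.Hist t × S.X0 × S.M0) × Option (S.X1 × S.M1) =>
      q.1.1.extend (φ.act t q.1.1)
        (S.next0 q.1.1.m0 q.1.1.x0 (φ.act t q.1.1) q.1.2.1, q.1.2.2, q.2) := by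
    fun_prop
  have hκ : (beliefKernel hφ (by omega) ×ₖ S.modeKernel (t + 1)).comap _ hf = erasurePosterior
      (Kernel.prodMkRight _ (predictKernel φ t (beliefKernel hφ (by omega)) ×ₖ
        Kernel.const _ (S.lawM1 : Measure S.M1))) := by
    ext ⟨⟨a, w⟩, o⟩ : 1
    rw [Kernel.comap_apply, Kernel.prod_apply, beliefKernel_apply,
      belief_succ hφ ht.le (κ := beliefKernel hφ (by omega)) rfl, modeKernel_apply,
      Hist.past_extend, Hist.z_extend, Hist.zt_extend, ← erasurePosterior_prod_modeLaw]
    cases o <;> rfl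
  convert HasCondDistrib.comp_right (hf := hf) (hκ ▸ hpost) using 1
  funext ω
  simp only [Function.comp_apply, m0_hist]
  rfl

theorem hasCondDistrib_state1_M1 (hφ : φ.IsMeasurable) (ht : t ≤ S.T) :
    HasCondDistrib (fun ω => (state1 N φ t ω, N.M1 t ω)) (hist N φ t)
      (beliefKernel hφ (by omega) ×ₖ S.modeKernel t) P := by
  induction t with
  | zero => exact hasCondDistrib_state1_M1_zero N hφ
  | succ t ih => exact hasCondDistrib_state1_M1_succ N hφ ht (ih (by omega))

theorem condProb_state1_ae_eq_belief (hφ : φ.IsMeasurable) (ht : t ≤ S.T) {E : Set S.X1}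
    (hE : MeasurableSet E) :
    P⟦state1 N φ t ⁻¹' E | MeasurableSpace.comap (hist N φ t) inferInstance⟧ =ᵐ[P]
      fun ω => (belief φ t (hist N φ t ω)).real E := by
  have h := (hasCondDistrib_state1_M1 N hφ ht).fst
  rw [Kernel.fst_prod] at h
  exact condProb_ae_eq_of_hasCondDistrib (measurable_hist N hφ ht) (measurable_state1 N hφ ht) h hE

theorem lintegral_hist_succ (hφ : φ.IsMeasurable) (ht : t < S.T) {f : S.Hist (t + 1) → ℝ≥0∞}
    (hf : Measurable f) :
    ∫⁻ ω, f (hist N φ (t + 1) ω) ∂P = ∫⁻ ω, ∫⁻ p, f (nextHist φ t (hist N φ t ω) p)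
      ∂S.stepLaw t (belief φ t (hist N φ t ω)) (hist N φ t ω).zt ∂P := by
  have hstep : HasCondDistrib (fun ω => (state1 N φ t ω, N.M1 t ω, innov N t ω)) (hist N φ t)
      (stepKernel hφ (by omega)) P :=
    hasCondDistrib_prodMk_prodMk_of_indepFun (hasCondDistrib_state1_M1 N hφ ht.le)
      (hasLaw_innov N ht) (N.indepFun_compl (A := {i | i.time = t + 1})
        (measurable_hist_state1_M1 N hφ ht.le (by simp +contextual))
        (measurable_innov N ht fun _ hi => hi))
  simp only [hist_succ, ← stepKernel_apply hφ (ht.le.trans (Nat.le_succ _))]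
  exact lintegral_of_hasCondDistrib hstep (hf.comp (measurable_nextHist hφ ht.le))

/-- The instantaneous cost at time `t` given the common information, the local state and the local
mode. -/
def stageCost (φ : S.Strategy) (t : ℕ) (h : S.Hist t) (y : S.X1 × S.M1) : ℝ :=
  S.cost t h.x0 y.1 h.m0 y.2 (φ.act t h) (φ.prs t h y)

theorem measurable_stageCost (hφ : φ.IsMeasurable) (ht : t ≤ S.T) :
    Measurable fun q : S.Hist t × S.X1 × S.M1 => stageCost φ t q.1 q.2 := by
  have ha := hφ.act t ht
  have hp := hφ.prs t ht
  unfold stageCost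
  fun_prop

/-- The total expected cost as an extended nonnegative real: it makes sense for every measurable
strategy, whatever the moments of its states and actions. -/
def expectedCost (φ : S.Strategy) : ℝ≥0∞ :=
  ∑ t ∈ Finset.range (S.T + 1),
    ∫⁻ ω, ENNReal.ofReal (stageCost φ t (hist N φ t ω) (state1 N φ t ω, N.M1 t ω)) ∂P

/-- The expected instantaneous cost at time `t` given the common information `h`. -/
def expectedStageCost (φ : S.Strategy) (t : ℕ) (h : S.Hist t) : ℝ≥0∞ :=
  ∫⁻ y, ENNReal.ofReal (stageCost φ t h y) ∂(belief φ t h).prod (S.modeLaw h.zt)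

/-- The expected cost of the `n` stages from time `t` on under `φ`, given the common
information. -/
def costToGo (φ : S.Strategy) : ℕ → (t : ℕ) → S.Hist t → ℝ≥0∞
  | 0, _, _ => 0
  | n + 1, t, h => expectedStageCost φ t h +
      ∫⁻ p, costToGo φ n (t + 1) (nextHist φ t h p) ∂S.stepLaw t (belief φ t h) h.zt

theorem expectedStageCost_eq_lintegral_kernel (hφ : φ.IsMeasurable) (ht : t ≤ S.T + 1)
    (h : S.Hist t) : expectedStageCost φ t h =
      ∫⁻ y, ENNReal.ofReal (stageCost φ t h y) ∂(beliefKernel hφ ht ×ₖ S.modeKernel t) h := by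
  rw [Kernel.prod_apply]
  rfl

theorem measurable_expectedStageCost (hφ : φ.IsMeasurable) (ht : t ≤ S.T) :
    Measurable (expectedStageCost φ t) := by
  simp only [funext (expectedStageCost_eq_lintegral_kernel hφ (ht.trans (Nat.le_succ _)))]
  exact Measurable.lintegral_kernel_prod_right' (measurable_stageCost hφ ht).ennreal_ofReal

theorem measurable_costToGo (hφ : φ.IsMeasurable) {n t : ℕ} (hn : t + n ≤ S.T + 1) :
    Measurable (costToGo φ n t) := by
  induction n generalizing t with
  | zero => exact measurable_const
  | succ n ih =>
    have hnext := Measurable.lintegral_kernel_prod_right' (κ := stepKernel hφ (by omega))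
      ((ih (by omega)).comp (measurable_nextHist hφ (t := t) (by omega)))
    simp only [stepKernel_apply] at hnext
    exact (measurable_expectedStageCost hφ (by omega)).add hnext

theorem lintegral_expectedStageCost (hφ : φ.IsMeasurable) (ht : t ≤ S.T) :
    ∫⁻ ω, expectedStageCost φ t (hist N φ t ω) ∂P =
      ∫⁻ ω, ENNReal.ofReal (stageCost φ t (hist N φ t ω) (state1 N φ t ω, N.M1 t ω)) ∂P := by
  simp only [expectedStageCost_eq_lintegral_kernel hφ (ht.trans (Nat.le_succ _))]
  exact (lintegral_of_hasCondDistrib (hasCondDistrib_state1_M1 N hφ ht)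
    (measurable_stageCost hφ ht).ennreal_ofReal).symm

theorem lintegral_costToGo (hφ : φ.IsMeasurable) {n t : ℕ} (hn : t + n = S.T + 1) :
    ∫⁻ ω, costToGo φ n t (hist N φ t ω) ∂P =
      ∑ s ∈ Finset.Ico t (S.T + 1),
        ∫⁻ ω, ENNReal.ofReal (stageCost φ s (hist N φ s ω) (state1 N φ s ω, N.M1 s ω)) ∂P := by
  induction n generalizing t with
  | zero => simp [costToGo, ← hn]
  | succ n ih =>
    have hstage : Measurable fun ω => expectedStageCost φ t (hist N φ t ω) :=
      (measurable_expectedStageCost hφ (by omega)).comp (measurable_hist N hφ (by omega))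
    rw [Finset.sum_eq_sum_Ico_succ_bot (by omega), ← ih (by omega),
      ← lintegral_expectedStageCost N hφ (by omega)]
    simp only [costToGo]
    rw [lintegral_add_left hstage]
    congr 1
    cases n with
    | zero => simp [costToGo]
    | succ n =>
      exact (lintegral_hist_succ N hφ (by omega) (measurable_costToGo hφ (by omega))).symm

theorem lintegral_costToGo_zero (hφ : φ.IsMeasurable) :
    ∫⁻ ω, costToGo φ (S.T + 1) 0 (hist N φ 0 ω) ∂P = expectedCost N φ := by
  rw [lintegral_costToGo N hφ (zero_add _), expectedCost, Finset.range_eq_Ico]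

end Noise

theorem cost_nonneg (ht : t ≤ S.T) (x0 : S.X0) (x1 : S.X1) (m0 : S.M0) (m1 : S.M1)
    (u0 : S.U0) (u1 : S.U1) : 0 ≤ S.cost t x0 x1 m0 m1 u0 u1 :=
  add_nonneg (quadratic_nonneg (S.Q_posSemidef t ht m0 m1) _)
    (quadratic_nonneg (S.R_posDef t ht m0 m1).posSemidef _)

theorem exists_norm_sq_le_cost (ht : t ≤ S.T) (m0 : S.M0) :
    ∃ C, ∀ x0 x1 m1 u0 u1, ‖u1‖ ^ 2 ≤ C * S.cost t x0 x1 m0 m1 u0 u1 := by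
  choose C hC hC' using fun m1 => exists_norm_sq_le_of_posDef (S.R_posDef t ht m0 m1)
  refine ⟨∑ m1, C m1, fun x0 x1 m1 u0 u1 => ?_⟩
  have hu : ‖u1‖ ≤ ‖Sum.elim u0 u1‖ :=
    (pi_norm_le_iff_of_nonneg (norm_nonneg _)).2 fun i => norm_le_pi_norm (Sum.elim u0 u1) (.inr i)
  calc ‖u1‖ ^ 2 ≤ ‖Sum.elim u0 u1‖ ^ 2 := by gcongr
    _ ≤ C m1 * (Sum.elim u0 u1 ⬝ᵥ (S.R t m0 m1 *ᵥ Sum.elim u0 u1)) := hC' _ _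
    _ ≤ C m1 * S.cost t x0 x1 m0 m1 u0 u1 :=
      mul_le_mul_of_nonneg_left
        (le_add_of_nonneg_left (quadratic_nonneg (S.Q_posSemidef t ht m0 m1) _)) (hC m1)
    _ ≤ (∑ m1, C m1) * S.cost t x0 x1 m0 m1 u0 u1 :=
      mul_le_mul_of_nonneg_right
        (Finset.single_le_sum (f := C) (fun m _ => hC m) (Finset.mem_univ m1))
        (cost_nonneg ht _ _ _ _ _ _)

theorem memLp_prescription_of_lintegral_cost_ne_top (ht : t ≤ S.T)
    {μ : Measure (S.X1 × S.M1)} {x0 : S.X0} {m0 : S.M0} {u0 : S.U0} {ρ : S.X1 × S.M1 → S.U1}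
    (hρ : Measurable ρ)
    (hc : ∫⁻ y, ENNReal.ofReal (S.cost t x0 y.1 m0 y.2 u0 (ρ y)) ∂μ ≠ ⊤) : MemLp ρ 2 μ := by
  obtain ⟨C, hle⟩ := exists_norm_sq_le_cost ht m0
  have hcost : Integrable (fun y => S.cost t x0 y.1 m0 y.2 u0 (ρ y)) μ := by
    refine ⟨Measurable.aestronglyMeasurable (by fun_prop), ?_⟩
    rw [hasFiniteIntegral_iff_ofReal (ae_of_all _ fun y => cost_nonneg ht _ _ _ _ _ _)]
    exact hc.lt_top
  rw [memLp_two_iff_integrable_sq_norm hρ.aestronglyMeasurable]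
  refine (hcost.const_mul C).mono' (hρ.norm.pow_const 2).aestronglyMeasurable ?_
  exact ae_of_all _ fun y => by simpa using hle x0 y.1 y.2 u0 (ρ y)

theorem memLp_id_dirac (y : S.X1) : MemLp id 2 (Measure.dirac y) :=
  (memLp_const y).ae_eq (ae_eq_dirac id).symm

theorem memLp_update (ht : t ≤ S.T) {θ : Measure S.X1} [IsProbabilityMeasure θ]
    (hθ : MemLp id 2 θ) (u0 : S.U0) {ρ : S.X1 × S.M1 → S.U1} (hρ : Measurable ρ) (x0 : S.X0)
    (m0 : S.M0) (zt : Option S.M1) (hρ2 : MemLp ρ 2 (θ.prod (S.modeLaw zt)))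
    (z : Option S.X1) : MemLp id 2 (S.update t θ u0 ρ x0 m0 zt z) := by
  cases z with
  | some y => exact memLp_id_dirac y
  | none =>
    rw [update, memLp_map_measure_iff measurable_id.aestronglyMeasurable (by fun_prop)]
    set μ := θ.prod ((S.modeLaw zt).prod (S.lawW1 t : Measure S.X1))
    have hx : MemLp (fun p : S.X1 × S.M1 × S.X1 => p.1) 2 μ :=
      hθ.comp_measurePreserving measurePreserving_fst
    have hw : MemLp (fun p : S.X1 × S.M1 × S.X1 => p.2.2) 2 μ :=
      (S.lawW1_memLp t ht).comp_measurePreserving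
        ((measurePreserving_snd (μ := S.modeLaw zt)).comp measurePreserving_snd)
    have hu : MemLp (fun p : S.X1 × S.M1 × S.X1 => ρ (p.1, p.2.1)) 2 μ :=
      hρ2.comp_measurePreserving ((MeasurePreserving.id θ).prod measurePreserving_fst)
    have hm1 : Measurable fun p : S.X1 × S.M1 × S.X1 => p.2.1 := by fun_prop
    exact ((((memLp_mulVec (S.A10 m0) hm1 measurable_const (memLp_const x0)).add
      (memLp_mulVec (S.A11 m0) hm1 measurable_fst hx)).add
      (memLp_mulVec (S.B10 m0) hm1 measurable_const (memLp_const u0))).add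
      (memLp_mulVec (S.B11 m0) hm1 (by fun_prop) hu)).add hw

theorem belief_zero_mem (φ : S.Strategy) (h : S.Hist 0) :
    IsProbabilityMeasure (belief φ 0 h) ∧ MemLp id 2 (belief φ 0 h) := by
  rw [belief]
  split
  · exact ⟨inferInstance, memLp_id_dirac _⟩
  · exact ⟨inferInstance, S.lawX1_memLp⟩

theorem belief_nextHist_mem (hφ : φ.IsMeasurable) (ht : t ≤ S.T) {h : S.Hist t}
    (hθ : MemLp id 2 (belief φ t h)) (hc : expectedStageCost φ t h ≠ ⊤)
    (p : S.X1 × S.M1 × S.Innov) :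
    IsProbabilityMeasure (belief φ (t + 1) (nextHist φ t h p)) ∧
      MemLp id 2 (belief φ (t + 1) (nextHist φ t h p)) := by
  have := isProbabilityMeasure_belief hφ (ht.trans (Nat.le_succ _)) h
  refine ⟨isProbabilityMeasure_belief hφ (Nat.succ_le_succ ht) _, ?_⟩
  rw [nextHist, belief_extend]
  exact memLp_update ht hθ _ (hφ.prs_apply ht h) _ _ _
    (memLp_prescription_of_lintegral_cost_ne_top ht (hφ.prs_apply ht h) hc) _

theorem extendTop_nonneg {v : S.Belief → ℝ} (hv : ∀ θ, 0 ≤ v θ) (θ : Measure S.X1) :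
    0 ≤ extendTop v θ := by
  unfold extendTop
  split
  · exact_mod_cast hv _
  · exact le_top

theorem toENNReal_extendTop {v : S.Belief → ℝ} {θ : Measure S.X1}
    (hθ : IsProbabilityMeasure θ ∧ MemLp id 2 θ) :
    (extendTop v θ).toENNReal = ENNReal.ofReal (v ⟨θ, hθ⟩) := by
  rw [extendTop, dif_pos hθ, EReal.toENNReal_of_ne_top (EReal.coe_ne_top _), EReal.toReal_coe]

theorem eexpect_coe_add_of_nonneg {μ : Measure α} {f : α → ℝ} {g : α → EReal}
    (hfm : Measurable f) (hf : ∀ a, 0 ≤ f a) (hg : ∀ a, 0 ≤ g a) :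
    eexpect μ (fun a => f a + g a) =
      ((∫⁻ a, ENNReal.ofReal (f a) ∂μ + ∫⁻ a, (g a).toENNReal ∂μ : ℝ≥0∞) : EReal) := by
  have hf' (a : α) : (0 : EReal) ≤ f a := EReal.coe_nonneg.2 (hf a)
  have hneg (a : α) : (-(f a + g a)).toENNReal = 0 :=
    EReal.toENNReal_of_nonpos (EReal.neg_le_zero.2 (add_nonneg (hf' a) (hg a)))
  have hpos (a : α) : (f a + g a).toENNReal = ENNReal.ofReal (f a) + (g a).toENNReal := by
    rw [EReal.toENNReal_add (hf' a) (hg a), EReal.toENNReal_of_ne_top (EReal.coe_ne_top _),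
      EReal.toReal_coe]
  simp only [eexpect, hneg, hpos, lintegral_zero, EReal.coe_ennreal_zero, sub_zero]
  rw [lintegral_add_left hfm.ennreal_ofReal]

theorem lintegral_stepLaw_fst {θ : Measure S.X1} [SFinite θ] (zt : Option S.M1)
    {f : S.X1 × S.M1 → ℝ≥0∞} (hf : Measurable f) :
    ∫⁻ p, f (p.1, p.2.1) ∂S.stepLaw t θ zt = ∫⁻ y, f y ∂θ.prod (S.modeLaw zt) :=
  ((MeasurePreserving.id θ).prod
    (measurePreserving_fst (μ := S.modeLaw zt) (ν := S.innovLaw t))).lintegral_comp hf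

theorem dpObjective_nonneg {V : S.ValueFn} (ht : t ≤ S.T)
    (hV : ∀ x0 m0 θ zt, 0 ≤ V (t + 1) x0 m0 θ zt) (x0 : S.X0) (m0 : S.M0) (θ : S.Belief)
    (zt : Option S.M1) (u0 : S.U0) {ρ : S.X1 × S.M1 → S.U1} (hρ : Measurable ρ) :
    0 ≤ S.dpObjective V t x0 m0 θ zt u0 ρ := by
  rw [dpObjective, eexpect_coe_add_of_nonneg (by fun_prop)
    (fun _ => cost_nonneg ht _ _ _ _ _ _) fun _ => extendTop_nonneg (fun θ' => hV _ _ θ' _) _]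
  exact EReal.coe_ennreal_nonneg _

theorem dpObjective_strategy {V : S.ValueFn} (hφ : φ.IsMeasurable) (ht : t ≤ S.T)
    (hV : ∀ x0 m0 θ zt, 0 ≤ V (t + 1) x0 m0 θ zt) (h : S.Hist t) (θ : S.Belief)
    (hθ : θ.1 = belief φ t h) :
    S.dpObjective V t h.x0 h.m0 θ h.zt (φ.act t h) (φ.prs t h) =
      ((expectedStageCost φ t h + ∫⁻ p, (extendTop (fun θ' => V (t + 1) (nextHist φ t h p).x0
        (nextHist φ t h p).m0 θ' (nextHist φ t h p).zt)
          (belief φ (t + 1) (nextHist φ t h p))).toENNReal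
            ∂S.stepLaw t (belief φ t h) h.zt : ℝ≥0∞) : EReal) := by
  have := isProbabilityMeasure_belief hφ (ht.trans (Nat.le_succ _)) h
  have hstage : Measurable (stageCost φ t h) :=
    (measurable_stageCost hφ ht).comp measurable_prodMk_left
  have hfst : Measurable fun p : S.X1 × S.M1 × S.Innov => (p.1, p.2.1) := by fun_prop
  rw [expectedStageCost, ← lintegral_stepLaw_fst (t := t) h.zt hstage.ennreal_ofReal]
  refine Eq.trans ?_ (eexpect_coe_add_of_nonneg (hstage.comp hfst)
    (fun _ => cost_nonneg ht _ _ _ _ _ _) fun p => extendTop_nonneg (fun θ' => hV _ _ θ' _) _)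
  simp only [dpObjective, hθ, nextHist, belief_extend, Hist.x0_extend, Hist.m0_extend,
    Hist.zt_extend]
  rfl

theorem SolvesDP.nonneg {V : S.ValueFn} (hV : S.SolvesDP V) {n t : ℕ} (hn : t + n = S.T + 1)
    (x0 : S.X0) (m0 : S.M0) (θ : S.Belief) (zt : Option S.M1) : 0 ≤ V t x0 m0 θ zt := by
  induction n generalizing t x0 m0 θ zt with
  | zero =>
    obtain rfl : t = S.T + 1 := hn
    exact (hV.terminal _ _ _ _).ge
  | succ n ih =>
    obtain ⟨u0, ρ, hρ, heq⟩ := (hV.step t (by omega) x0 m0 θ zt).1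
    exact EReal.coe_nonneg.1
      (heq.symm ▸ dpObjective_nonneg (by omega) (ih (by omega)) x0 m0 θ zt u0 hρ)

theorem SolvesDP.le_costToGo {V : S.ValueFn} (hV : S.SolvesDP V) (hφ : φ.IsMeasurable) {n t : ℕ}
    (hn : t + n = S.T + 1) (h : S.Hist t) (θ : S.Belief) (hθ : θ.1 = belief φ t h) :
    ENNReal.ofReal (V t h.x0 h.m0 θ h.zt) ≤ costToGo φ n t h := by
  induction n generalizing t θ with
  | zero =>
    obtain rfl : t = S.T + 1 := hn
    simp [hV.terminal]
  | succ n ih =>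
    have ht : t ≤ S.T := by omega
    by_cases hc : expectedStageCost φ t h = ⊤
    · rw [costToGo, hc, top_add]
      exact le_top
    have hmin := (hV.step t ht h.x0 h.m0 θ h.zt).2 ⟨φ.act t h, φ.prs t h, hφ.prs_apply ht h, rfl⟩
    rw [dpObjective_strategy hφ ht (hV.nonneg (n := n) (by omega)) h θ hθ,
      ← max_eq_left (hV.nonneg hn h.x0 h.m0 θ h.zt), ← EReal.coe_ennreal_ofReal,
      EReal.coe_ennreal_le_coe_ennreal_iff] at hmin
    refine hmin.trans (add_le_add le_rfl (lintegral_mono fun p => ?_))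
    have hmem := belief_nextHist_mem hφ ht (hθ ▸ θ.2.2) hc p
    exact (toENNReal_extendTop hmem).trans_le (ih (by omega) _ ⟨_, hmem⟩ rfl)

theorem SolvesDP.costToGo_le {V : S.ValueFn} (hV : S.SolvesDP V) (hφ : φ.IsMeasurable)
    (hmin : S.AttainsDP V φ) {n t : ℕ} (hn : t + n = S.T + 1) (h : S.Hist t) (θ : S.Belief)
    (hθ : θ.1 = belief φ t h) :
    costToGo φ n t h ≤ ENNReal.ofReal (V t h.x0 h.m0 θ h.zt) := by
  induction n generalizing t θ with
  | zero => exact zero_le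
  | succ n ih =>
    have ht : t ≤ S.T := by omega
    have heq := hmin t ht h θ hθ
    rw [dpObjective_strategy hφ ht (hV.nonneg (n := n) (by omega)) h θ hθ,
      ← max_eq_left (hV.nonneg hn h.x0 h.m0 θ h.zt), ← EReal.coe_ennreal_ofReal,
      EReal.coe_ennreal_eq_coe_ennreal_iff] at heq
    have hc : expectedStageCost φ t h ≠ ⊤ :=
      (le_self_add.trans_lt (heq ▸ ENNReal.ofReal_lt_top)).ne
    rw [← heq]
    refine add_le_add le_rfl (lintegral_mono fun p => ?_)
    have hmem := belief_nextHist_mem hφ ht (hθ ▸ θ.2.2) hc p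
    refine (ih (by omega) _ ⟨_, hmem⟩ rfl).trans ?_
    exact (toENNReal_extendTop hmem).ge

section Noise

variable {Ω : Type*} [MeasurableSpace Ω] {P : Measure Ω} (N : S.Noise P)

theorem SolvesDP.expectedCost_le [IsProbabilityMeasure P] {V : S.ValueFn} (hV : S.SolvesDP V)
    (hφ : φ.IsMeasurable) (hmin : S.AttainsDP V φ) {φ' : S.Strategy} (hφ' : φ'.IsMeasurable) :
    expectedCost N φ ≤ expectedCost N φ' := by
  rw [← lintegral_costToGo_zero N hφ, ← lintegral_costToGo_zero N hφ']
  refine lintegral_mono fun ω => ?_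
  calc costToGo φ (S.T + 1) 0 (hist N φ 0 ω)
      ≤ _ := hV.costToGo_le hφ hmin (zero_add _) _ ⟨_, belief_zero_mem φ _⟩ rfl
    _ ≤ costToGo φ' (S.T + 1) 0 (hist N φ' 0 ω) :=
      hV.le_costToGo hφ' (zero_add _) (hist N φ' 0 ω) ⟨_, belief_zero_mem φ' _⟩ rfl

theorem totalCost_nonneg (φ : S.Strategy) : 0 ≤ totalCost N φ :=
  integral_nonneg fun _ => Finset.sum_nonneg fun _ ht =>
    cost_nonneg (Nat.lt_succ_iff.1 (Finset.mem_range.1 ht)) _ _ _ _ _ _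

theorem Feasible.integrable_stageCost {N : S.Noise P} (hφ : Feasible N φ) (ht : t ≤ S.T) :
    Integrable (fun ω => stageCost φ t (hist N φ t ω) (state1 N φ t ω, N.M1 t ω)) P := by
  have hh := measurable_hist N hφ.isMeasurable ht
  have hs := measurable_state1 N hφ.isMeasurable ht
  have hM := N.measurable_M1 t ht
  have h0 : Measurable (state0 N φ t) := Hist.measurable_x0.comp hh
  have ha : Measurable (ctrl0 N φ t) := (hφ.measurable_act t ht).comp hh
  have hp : Measurable (ctrl1 N φ t) := (hφ.measurable_prs t ht).comp (hh.prodMk (hs.prodMk hM))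
  have hm : Measurable fun ω => ((hist N φ t ω).m0, N.M1 t ω) :=
    (Hist.measurable_m0.comp hh).prodMk hM
  have hQ := integrable_quadratic (fun q : S.M0 × S.M1 => S.Q t q.1 q.2) hm
    (measurable_sumElim h0 hs) (memLp_sumElim (hφ.state0_memLp t ht) (hφ.state1_memLp t ht))
  have hR := integrable_quadratic (fun q : S.M0 × S.M1 => S.R t q.1 q.2) hm
    (measurable_sumElim ha hp) (memLp_sumElim (hφ.ctrl0_memLp t ht) (hφ.ctrl1_memLp t ht))
  exact hQ.add hR

theorem Feasible.ofReal_totalCost {N : S.Noise P} (hφ : Feasible N φ) :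
    ENNReal.ofReal (totalCost N φ) = expectedCost N φ := by
  have hle {t : ℕ} (ht : t ∈ Finset.range (S.T + 1)) : t ≤ S.T :=
    Nat.lt_succ_iff.1 (Finset.mem_range.1 ht)
  have hnn {t : ℕ} (ht : t ∈ Finset.range (S.T + 1)) (ω : Ω) :
      0 ≤ stageCost φ t (hist N φ t ω) (state1 N φ t ω, N.M1 t ω) :=
    cost_nonneg (hle ht) _ _ _ _ _ _
  have hcost : totalCost N φ = ∫ ω, ∑ t ∈ Finset.range (S.T + 1),
      stageCost φ t (hist N φ t ω) (state1 N φ t ω, N.M1 t ω) ∂P := by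
    simp only [stageCost, m0_hist]
    rfl
  rw [hcost, integral_finsetSum _ fun t ht => hφ.integrable_stageCost (hle ht),
    ENNReal.ofReal_sum_of_nonneg fun t ht => integral_nonneg (hnn ht)]
  exact Finset.sum_congr rfl fun t ht =>
    ofReal_integral_eq_lintegral_ofReal (hφ.integrable_stageCost (hle ht)) (ae_of_all _ (hnn ht))

theorem Feasible.totalCost_le_iff {N : S.Noise P} (hφ : Feasible N φ) {φ' : S.Strategy}
    (hφ' : Feasible N φ') :
    totalCost N φ ≤ totalCost N φ' ↔ expectedCost N φ ≤ expectedCost N φ' := by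
  rw [← ENNReal.ofReal_le_ofReal_iff (totalCost_nonneg N φ'), hφ.ofReal_totalCost,
    hφ'.ofReal_totalCost]

end Noise

end SwitchedSystem

end

end NCS

theorem theorem1_general (S : NCS.SwitchedSystem) {Ω : Type*} [MeasurableSpace Ω]
    (P : Measure Ω) [IsProbabilityMeasure P] (N : S.Noise P)
    (V : S.ValueFn) (hV : S.SolvesDP V)
    (φ : S.Strategy) (hφ : φ.IsMeasurable) (hmin : S.AttainsDP V φ) :
    (∀ φ' : S.Strategy, φ'.IsMeasurable →
      NCS.SwitchedSystem.expectedCost N φ ≤ NCS.SwitchedSystem.expectedCost N φ') ∧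
      ∀ φ' : S.Strategy, φ'.IsMeasurable →
        ∀ t ≤ S.T, ∀ E : Set S.X1, MeasurableSet E →
          P⟦NCS.SwitchedSystem.state1 N φ' t ⁻¹' E |
              MeasurableSpace.comap (NCS.SwitchedSystem.hist N φ' t) inferInstance⟧ =ᵐ[P]
            fun ω => (NCS.SwitchedSystem.belief φ' t (NCS.SwitchedSystem.hist N φ' t ω)).real E :=
  ⟨fun _ hφ' => hV.expectedCost_le N hφ hmin hφ', fun _ hφ' _ ht _ hE =>
    NCS.SwitchedSystem.condProb_state1_ae_eq_belief N hφ' ht hE⟩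

theorem theorem1 (S : NCS.SwitchedSystem) {Ω : Type*} [MeasurableSpace Ω]
    (P : Measure Ω) [IsProbabilityMeasure P] (N : S.Noise P)
    (V : S.ValueFn) (hV : S.SolvesDP V)
    (φ : S.Strategy) (hφ : NCS.SwitchedSystem.Feasible N φ) (hmin : S.AttainsDP V φ) :
    NCS.SwitchedSystem.IsOptimal N φ ∧
      ∀ φ' : S.Strategy, NCS.SwitchedSystem.Feasible N φ' →
        ∀ t ≤ S.T, ∀ E : Set S.X1, MeasurableSet E →
          P⟦NCS.SwitchedSystem.state1 N φ' t ⁻¹' E |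
              MeasurableSpace.comap (NCS.SwitchedSystem.hist N φ' t) inferInstance⟧ =ᵐ[P]
            fun ω => (NCS.SwitchedSystem.belief φ' t (NCS.SwitchedSystem.hist N φ' t ω)).real E :=
  have hgen := theorem1_general S P N V hV φ hφ.isMeasurable hmin
  ⟨⟨hφ, fun φ' hφ' => (hφ.totalCost_le_iff hφ').2 (hgen.1 φ' hφ'.isMeasurable)⟩,
    fun φ' hφ' => hgen.2 φ' hφ'.isMeasurable⟩
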